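/- Let $\mathcal K$ be a tensor triangulated category: an essentially small triangulated category (with suspension $T$) with a symmetric monoidal structure $(\otimes,\mathbf 1)$ such that all functors $a\otimes-$ and $-\otimes b$ are exact, the isomorphisms $a\otimes Tb\cong T(a\otimes b)\cong Ta\otimes b$ being natural in $a$ and $b$, and such that the two induced isomorphisms $Ta\otimes Tb\cong T^2(a\otimes b)$ differ by the sign $-1$. Assume that $\mathcal K$ is idempotent complete and strongly closed, i.e. that there is an internal hom functor $\underline{\hom}$, exact in each variable, with natural isomorphisms $\mathrm{Hom}(a\otimes b,c)\cong\mathrm{Hom}(a,\underline{\hom}(b,c))$, such that the natural morphism $\underline{\hom}(a,\mathbf 1)\otimes b\to\underline{\hom}(a,b)$ is an isomorphism for all $a,b$. A thick $\otimes$-ideal is a full triangulated subcategory closed under direct summands and under tensoring with arbitrary objects; it is prime if it is proper and if $a\otimes b\in\mathcal P$ implies $a\in\mathcal P$ or $b\in\mathcal P$. Let $\mathrm{Spc}(\mathcal K)$ be the set of primes, $\mathrm{supp}(a)=\{\mathcal P\mid a\notin\mathcal P\}$, and give $\mathrm{Spc}(\mathcal K)$ the topology with basis of open sets the complements of the $\mathrm{supp}(a)$,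 $a\in\mathcal K$. For $Y\subset\mathrm{Spc}(\mathcal K)$ let $\mathcal K_Y$ be the full subcategory of those $a$ with $\mathrm{supp}(a)\subset Y$. For $U\subset\mathrm{Spc}(\mathcal K)$ with complement $Z$, let $\mathcal K(U)$ be the idempotent completion of the Verdier quotient $\mathcal K/\mathcal K_Z$, with its induced triangulation and tensor product, and let $\rho:\mathcal K\to\mathcal K(U)$ be the canonical (restriction) functor. Let $\mathcal K(U)_Y$ be the full subcategory of those $b\in\mathcal K(U)$ such that $\rho^{-1}(\mathcal Q)\in Y$ for every prime $\mathcal Q$ of $\mathcal K(U)$ with $b\notin\mathcal Q$. **Theorem (Excision).** Let $Y\subset U\subset\mathrm{Spc}(\mathcal K)$, where $Y=\bigcup_{\alpha\in A}Y_\alpha$ with every $Y_\alpha$ closed with quasi-compact complement, and $U=\bigcap_{\beta\in B}U_\beta$ with every $U_\beta$ open and quasi-compact. Then $\rho$ restricts to an equivalence of categories $$\mathcal K_Y\;\xrightarrow{\ \sim\ }\;\mathcal K(U)_Y .$$ -/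

import Mathlib

open CategoryTheory Category Limits Pretriangulated Idempotents MonoidalCategory
open scoped ZeroObject

noncomputable section

namespace KaroubiEnvelope

universe v u
variable {C : Type u} [Category.{v} C]

section Shift
variable [HasShift C ℤ]

/-- The shift by `n` on the idempotent completion, `(X, p) ↦ (X⟦n⟧, p⟦n⟧)`. -/
def shift (C : Type u) [Category.{v} C] [HasShift C ℤ] (n : ℤ) : Karoubi C ⥤ Karoubi C :=
  (functorExtension₂ C C).obj (shiftFunctor C n)

/-- The shift on the idempotent completion extends the shift of `C`. -/
def shiftIso (C : Type u) [Category.{v} C] [HasShift C ℤ] (n : ℤ) :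
    toKaroubi C ⋙ shift C n ≅ shiftFunctor C n ⋙ toKaroubi C :=
  (functorExtension₂CompWhiskeringLeftToKaroubiIso C C).app (shiftFunctor C n)

/-- The shift on the idempotent completion, with the coherence isomorphisms induced from `C`. -/
instance hasShift : HasShift (Karoubi C) ℤ :=
  HasShift.induced (toKaroubi C) ℤ (shift C) (shiftIso C)

instance commShift : (toKaroubi C).CommShift ℤ :=
  Functor.CommShift.ofInduced (toKaroubi C) ℤ (shift C) (shiftIso C)

end Shift

section Additive
variable [Preadditive C]

instance [HasZeroObject C] : HasZeroObject (Karoubi C) :=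
  (toKaroubi C).hasZeroObject_of_additive

instance [HasShift C ℤ] [∀ n : ℤ, (shiftFunctor C n).Additive] (n : ℤ) :
    (shiftFunctor (Karoubi C) n).Additive where
  map_add {P Q f g} := by
    ext
    change (f.f + g.f)⟦n⟧' = f.f⟦n⟧' + g.f⟦n⟧'
    rw [Functor.map_add]

end Additive
section Triangulation
variable [Preadditive C] [HasZeroObject C] [HasShift C ℤ]
  [∀ n : ℤ, (shiftFunctor C n).Additive] [Pretriangulated C]

variable (C) in
/-- The distinguished triangles of the idempotent completion: the direct summands of
(images of) distinguished triangles of `C`. -/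
def distinguished : Set (Triangle (Karoubi C)) :=
  {T | ∃ T₀ ∈ distTriang C, Nonempty (Retract T ((toKaroubi C).mapTriangle.obj T₀))}

lemma distinguished_of_retract {T T' : Triangle (Karoubi C)} (h : Retract T T')
    (hT' : T' ∈ distinguished C) : T ∈ distinguished C := by
  obtain ⟨T₀, hT₀, ⟨r⟩⟩ := hT'
  exact ⟨T₀, hT₀, ⟨h.trans r⟩⟩

lemma distinguished_map {T : Triangle C} (hT : T ∈ distTriang C) :
    (toKaroubi C).mapTriangle.obj T ∈ distinguished C :=
  ⟨T, hT, ⟨Retract.refl _⟩⟩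

lemma contractible_mem (X : Karoubi C) : contractibleTriangle X ∈ distinguished C := by
  have h := distinguished_map (contractible_distinguished X.X)
  let e : contractibleTriangle ((toKaroubi C).obj X.X) ≅
      (toKaroubi C).mapTriangle.obj (contractibleTriangle X.X) :=
    Triangle.isoMk _ _ (Iso.refl _) (Iso.refl _) (toKaroubi C).mapZeroObject.symm
      (Karoubi.hom_ext _ _ (by change 𝟙 X.X ≫ 𝟙 X.X = 𝟙 X.X ≫ 𝟙 X.X; rfl))
      (Karoubi.hom_ext _ _ (by
        change (0 : X.X ⟶ _) ≫ _ = 𝟙 X.X ≫ (0 : X.X ⟶ _); rw [zero_comp, comp_zero]))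
      (Karoubi.hom_ext _ _ (by
        change (0 : (0 : Karoubi C).X ⟶ X.X⟦(1 : ℤ)⟧) ≫ (𝟙 X.X)⟦(1 : ℤ)⟧' =
          ((toKaroubi C).mapZeroObject.inv.f : (0 : Karoubi C).X ⟶ (0 : C)) ≫
            (0 : (0 : C) ⟶ X.X⟦(1 : ℤ)⟧) ≫ 𝟙 _
        rw [zero_comp, zero_comp, comp_zero]))
  refine distinguished_of_retract ?_ h
  exact (X.retract.map (contractibleTriangleFunctor (Karoubi C))).trans (.ofIso e)

lemma rotate_mem {T : Triangle (Karoubi C)} (h : T ∈ distinguished C) :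
    T.rotate ∈ distinguished C := by
  obtain ⟨T₀, hT₀, ⟨r⟩⟩ := h
  exact ⟨_, rot_of_distTriang _ hT₀,
    ⟨(r.map (rotate (Karoubi C))).trans (.ofIso ((toKaroubi C).mapTriangleRotateIso.app T₀))⟩⟩

lemma invRotate_mem {T : Triangle (Karoubi C)} (h : T ∈ distinguished C) :
    T.invRotate ∈ distinguished C := by
  obtain ⟨T₀, hT₀, ⟨r⟩⟩ := h
  exact ⟨_, inv_rot_of_distTriang _ hT₀,
    ⟨(r.map (invRotate (Karoubi C))).trans
      (.ofIso ((toKaroubi C).mapTriangleInvRotateIso.app T₀))⟩⟩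

lemma exists_idempotent_lift (T : Triangle C) (hT : T ∈ distTriang C)
    (p : T.obj₁ ⟶ T.obj₁) (q : T.obj₂ ⟶ T.obj₂) (hp : p ≫ p = p) (hq : q ≫ q = q)
    (fac : T.mor₁ ≫ q = p ≫ T.mor₁) :
    ∃ e : T.obj₃ ⟶ T.obj₃, e ≫ e = e ∧ T.mor₂ ≫ e = q ≫ T.mor₂ ∧
      T.mor₃ ≫ p⟦(1 : ℤ)⟧' = e ≫ T.mor₃ := by
  obtain ⟨c, hc₁, hc₂⟩ := complete_distinguished_triangle_morphism T T hT hT p q fac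
  obtain ⟨d, hd⟩ : ∃ d, d = c ≫ c - c := ⟨_, rfl⟩
  have h₁ : T.mor₂ ≫ d = 0 := by
    rw [hd, Preadditive.comp_sub, reassoc_of% hc₁, hc₁, reassoc_of% hq, sub_self]
  have h₂ : d ≫ T.mor₃ = 0 := by
    rw [hd, Preadditive.sub_comp, assoc, ← hc₂, ← reassoc_of% hc₂, ← Functor.map_comp, hp,
      sub_self]
  obtain ⟨k, hk⟩ := Triangle.coyoneda_exact₃ T hT d h₂
  have h₃ : d ≫ d = 0 := by
    nth_rw 1 [hk]
    rw [assoc, h₁, comp_zero]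
  have hcc : c ≫ c = c + d := by rw [hd]; abel
  have hcd : d ≫ c = c ≫ d := by simp [hd]
  have hccd : c ≫ c ≫ d = c ≫ d := by
    rw [← assoc, hcc, Preadditive.add_comp, h₃, add_zero]
  refine ⟨c + d - c ≫ d - c ≫ d, ?_, ?_, ?_⟩
  · simp only [Preadditive.add_comp, Preadditive.sub_comp, Preadditive.comp_add,
      Preadditive.comp_sub, assoc, h₃, hcd, hcc, reassoc_of% hcd, hccd, comp_zero]
    abel
  · simp only [Preadditive.comp_add, Preadditive.comp_sub, reassoc_of% hc₁, hc₁, h₁, comp_zero,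
      add_zero, sub_zero]
  · simp only [Preadditive.add_comp, Preadditive.sub_comp, assoc, h₂, comp_zero, hc₂,
      add_zero, sub_zero]

lemma exists_cone {X Y : Karoubi C} (f : X ⟶ Y) :
    ∃ (Z : Karoubi C) (g : Y ⟶ Z) (h : Z ⟶ X⟦(1 : ℤ)⟧),
      Triangle.mk f g h ∈ distinguished C := by
  obtain ⟨Z, g, h, H⟩ := distinguished_cocone_triangle f.f
  obtain ⟨e, he, hg, hh⟩ : ∃ e : Z ⟶ Z, e ≫ e = e ∧ g ≫ e = Y.p ≫ g ∧
      h ≫ X.p⟦(1 : ℤ)⟧' = e ≫ h :=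
    exists_idempotent_lift _ H X.p Y.p X.idem Y.idem ((Karoubi.p_comm f).symm)
  refine ⟨⟨Z, e, he⟩, ⟨Y.p ≫ g, ?_⟩, ⟨e ≫ h, ?_⟩, _, H, ⟨?_⟩⟩
  · simp [hg]
  · change e ≫ (e ≫ h) ≫ X.p⟦(1 : ℤ)⟧' = e ≫ h
    simp only [assoc, hh, reassoc_of% he]
  refine
    { i := Triangle.homMk _ _ ⟨X.p, ?_⟩ ⟨Y.p, ?_⟩ ⟨e, ?_⟩ ?_ ?_ ?_
      r := Triangle.homMk _ _ ⟨X.p, ?_⟩ ⟨Y.p, ?_⟩ ⟨e, ?_⟩ ?_ ?_ ?_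
      retract := ?_ }
  · change X.p ≫ X.p ≫ 𝟙 X.X = X.p
    simp
  · change Y.p ≫ Y.p ≫ 𝟙 Y.X = Y.p
    simp
  · change e ≫ e ≫ 𝟙 Z = e
    simp [he]
  · apply Karoubi.hom_ext
    change f.f ≫ Y.p = X.p ≫ f.f
    simp
  · apply Karoubi.hom_ext
    change (Y.p ≫ g) ≫ e = Y.p ≫ g
    simp [hg]
  · apply Karoubi.hom_ext
    change (e ≫ h) ≫ X.p⟦(1 : ℤ)⟧' = e ≫ h ≫ 𝟙 _
    rw [assoc, hh, reassoc_of% he, comp_id]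
  · change 𝟙 X.X ≫ X.p ≫ X.p = X.p
    simp
  · change 𝟙 Y.X ≫ Y.p ≫ Y.p = Y.p
    simp
  · change 𝟙 Z ≫ e ≫ e = e
    simp [he]
  · apply Karoubi.hom_ext
    change f.f ≫ Y.p = X.p ≫ f.f
    simp
  · apply Karoubi.hom_ext
    change g ≫ e = Y.p ≫ Y.p ≫ g
    simp [hg]
  · apply Karoubi.hom_ext
    change (h ≫ 𝟙 _) ≫ X.p⟦(1 : ℤ)⟧' = e ≫ e ≫ h
    rw [comp_id, hh, reassoc_of% he]
  · ext
    · exact X.idem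
    · exact Y.idem
    · exact he

/-- The triangulation of the idempotent completion of a triangulated category. -/
instance pretriangulated : Pretriangulated (Karoubi C) where
  distinguishedTriangles := distinguished C
  isomorphic_distinguished _ h _ e := distinguished_of_retract (.ofIso e) h
  contractible_distinguished := contractible_mem
  distinguished_cocone_triangle := exists_cone
  rotate_distinguished_triangle T :=
    ⟨rotate_mem, fun h => distinguished_of_retract
      (.ofIso ((triangleRotation (Karoubi C)).unitIso.app T)) (invRotate_mem h)⟩
  complete_distinguished_triangle_morphism := by
    rintro T₁ T₂ ⟨T₁', h₁, ⟨r₁⟩⟩ ⟨T₂', h₂, ⟨r₂⟩⟩ a b fac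
    obtain ⟨c, hc₁, hc₂⟩ := complete_distinguished_triangle_morphism T₁' T₂' h₁ h₂
      (r₁.r.hom₁ ≫ a ≫ r₂.i.hom₁).f (r₁.r.hom₂ ≫ b ≫ r₂.i.hom₂).f (by
        have : ((toKaroubi C).mapTriangle.obj T₁').mor₁ ≫ r₁.r.hom₂ ≫ b ≫ r₂.i.hom₂ =
            (r₁.r.hom₁ ≫ a ≫ r₂.i.hom₁) ≫ ((toKaroubi C).mapTriangle.obj T₂').mor₁ := by
          rw [reassoc_of% r₁.r.comm₁, reassoc_of% fac, assoc, assoc, r₂.i.comm₁]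
        exact congrArg Karoubi.Hom.f this)
    let c' : ((toKaroubi C).mapTriangle.obj T₁').obj₃ ⟶ ((toKaroubi C).mapTriangle.obj T₂').obj₃ :=
      (toKaroubi C).map c
    have h₂' : ((toKaroubi C).mapTriangle.obj T₁').mor₂ ≫ c' =
        (r₁.r.hom₂ ≫ b ≫ r₂.i.hom₂) ≫ ((toKaroubi C).mapTriangle.obj T₂').mor₂ :=
      Karoubi.hom_ext _ _ hc₁
    have h₃' : ((toKaroubi C).mapTriangle.obj T₁').mor₃ ≫
        (r₁.r.hom₁ ≫ a ≫ r₂.i.hom₁)⟦(1 : ℤ)⟧' =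
        c' ≫ ((toKaroubi C).mapTriangle.obj T₂').mor₃ := by
      apply Karoubi.hom_ext
      change (T₁'.mor₃ ≫ 𝟙 _) ≫ (r₁.r.hom₁ ≫ a ≫ r₂.i.hom₁).f⟦(1 : ℤ)⟧' =
        c ≫ T₂'.mor₃ ≫ 𝟙 _
      rw [comp_id, comp_id]
      exact hc₂
    have e₁ : r₁.i.hom₁ ≫ r₁.r.hom₁ = 𝟙 _ := congrArg TriangleMorphism.hom₁ r₁.retract
    have e₂ : r₁.i.hom₂ ≫ r₁.r.hom₂ = 𝟙 _ := congrArg TriangleMorphism.hom₂ r₁.retract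
    have e₁' : r₂.i.hom₁ ≫ r₂.r.hom₁ = 𝟙 _ := congrArg TriangleMorphism.hom₁ r₂.retract
    have e₂' : r₂.i.hom₂ ≫ r₂.r.hom₂ = 𝟙 _ := congrArg TriangleMorphism.hom₂ r₂.retract
    refine ⟨r₁.i.hom₃ ≫ c' ≫ r₂.r.hom₃, ?_, ?_⟩
    · rw [reassoc_of% r₁.i.comm₂, reassoc_of% h₂', r₂.r.comm₂, reassoc_of% e₂,
        reassoc_of% e₂']
    · have : a = r₁.i.hom₁ ≫ (r₁.r.hom₁ ≫ a ≫ r₂.i.hom₁) ≫ r₂.r.hom₁ := by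
        simp only [assoc, reassoc_of% e₁, e₁', comp_id]
      rw [this, Functor.map_comp, Functor.map_comp, reassoc_of% r₁.i.comm₃, reassoc_of% h₃',
        assoc, assoc, r₂.r.comm₃]

instance : (toKaroubi C).IsTriangulated where
  map_distinguished _ h := distinguished_map h

end Triangulation
section Monoidal
variable [MonoidalCategory C]

/-- The tensor product on the idempotent completion,
`(X, p) ⊗ (Y, q) = (X ⊗ Y, p ⊗ q)`. -/
instance monoidalStruct : MonoidalCategoryStruct (Karoubi C) where
  tensorObj P Q := ⟨P.X ⊗ Q.X, P.p ⊗ₘ Q.p, by rw [tensorHom_comp_tensorHom, P.idem, Q.idem]⟩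
  tensorHom f g := ⟨f.f ⊗ₘ g.f, by simp only [tensorHom_comp_tensorHom, f.comm, g.comm]⟩
  whiskerLeft P _ _ g := ⟨P.p ⊗ₘ g.f, by simp only [tensorHom_comp_tensorHom, P.idem, g.comm]⟩
  whiskerRight f Q := ⟨f.f ⊗ₘ Q.p, by simp only [tensorHom_comp_tensorHom, Q.idem, f.comm]⟩
  tensorUnit := ⟨𝟙_ C, 𝟙 (𝟙_ C), comp_id _⟩
  associator P Q R :=
    { hom := ⟨((P.p ⊗ₘ Q.p) ⊗ₘ R.p) ≫ (α_ P.X Q.X R.X).hom, by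
        simp only [assoc, ← associator_naturality,
          tensorHom_comp_tensorHom, tensorHom_comp_tensorHom_assoc, P.idem, Q.idem, R.idem]⟩
      inv := ⟨(P.p ⊗ₘ (Q.p ⊗ₘ R.p)) ≫ (α_ P.X Q.X R.X).inv, by
        simp only [assoc, ← associator_inv_naturality,
          tensorHom_comp_tensorHom, tensorHom_comp_tensorHom_assoc, P.idem, Q.idem, R.idem]⟩
      hom_inv_id := by
        apply Karoubi.hom_ext
        change (((P.p ⊗ₘ Q.p) ⊗ₘ R.p) ≫ (α_ P.X Q.X R.X).hom) ≫
          (P.p ⊗ₘ (Q.p ⊗ₘ R.p)) ≫ (α_ P.X Q.X R.X).inv = (P.p ⊗ₘ Q.p) ⊗ₘ R.p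
        simp only [assoc, ← associator_naturality_assoc,
          tensorHom_comp_tensorHom, P.idem, Q.idem, R.idem, Iso.hom_inv_id, comp_id]
      inv_hom_id := by
        apply Karoubi.hom_ext
        change ((P.p ⊗ₘ (Q.p ⊗ₘ R.p)) ≫ (α_ P.X Q.X R.X).inv) ≫
          ((P.p ⊗ₘ Q.p) ⊗ₘ R.p) ≫ (α_ P.X Q.X R.X).hom = P.p ⊗ₘ (Q.p ⊗ₘ R.p)
        simp only [assoc, ← associator_inv_naturality_assoc,
          tensorHom_comp_tensorHom, P.idem, Q.idem, R.idem, Iso.inv_hom_id, comp_id] }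
  leftUnitor P :=
    { hom := ⟨(λ_ P.X).hom ≫ P.p, by
        simp only [assoc, P.idem]
        rw [id_tensorHom, leftUnitor_naturality_assoc, P.idem]⟩
      inv := ⟨P.p ≫ (λ_ P.X).inv, by
        simp only [assoc]
        rw [id_tensorHom, ← leftUnitor_inv_naturality, reassoc_of% P.idem, reassoc_of% P.idem]⟩
      hom_inv_id := by
        apply Karoubi.hom_ext
        change ((λ_ P.X).hom ≫ P.p) ≫ P.p ≫ (λ_ P.X).inv = 𝟙 _ ⊗ₘ P.p
        rw [assoc, reassoc_of% P.idem, id_tensorHom, leftUnitor_inv_naturality,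
          Iso.hom_inv_id_assoc]
      inv_hom_id := by
        apply Karoubi.hom_ext
        change (P.p ≫ (λ_ P.X).inv) ≫ (λ_ P.X).hom ≫ P.p = P.p
        rw [assoc, Iso.inv_hom_id_assoc, P.idem] }
  rightUnitor P :=
    { hom := ⟨(ρ_ P.X).hom ≫ P.p, by
        simp only [assoc, P.idem]
        rw [tensorHom_id, rightUnitor_naturality_assoc, P.idem]⟩
      inv := ⟨P.p ≫ (ρ_ P.X).inv, by
        simp only [assoc]
        rw [tensorHom_id, ← rightUnitor_inv_naturality, reassoc_of% P.idem,
          reassoc_of% P.idem]⟩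
      hom_inv_id := by
        apply Karoubi.hom_ext
        change ((ρ_ P.X).hom ≫ P.p) ≫ P.p ≫ (ρ_ P.X).inv = P.p ⊗ₘ 𝟙 _
        rw [assoc, reassoc_of% P.idem, tensorHom_id, rightUnitor_inv_naturality,
          Iso.hom_inv_id_assoc]
      inv_hom_id := by
        apply Karoubi.hom_ext
        change (P.p ≫ (ρ_ P.X).inv) ≫ (ρ_ P.X).hom ≫ P.p = P.p
        rw [assoc, Iso.inv_hom_id_assoc, P.idem] }

instance monoidal : MonoidalCategory (Karoubi C) :=
  .ofTensorHom
    (id_tensorHom_id := fun _ _ => rfl)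
    (id_tensorHom := fun _ _ _ _ => rfl)
    (tensorHom_id := fun _ _ => rfl)
    (tensorHom_comp_tensorHom := fun f₁ f₂ g₁ g₂ =>
      Karoubi.hom_ext _ _ (tensorHom_comp_tensorHom f₁.f f₂.f g₁.f g₂.f))
    (associator_naturality := fun {X₁ X₂ X₃ Y₁ Y₂ Y₃} f₁ f₂ f₃ => by
      apply Karoubi.hom_ext
      change ((f₁.f ⊗ₘ f₂.f) ⊗ₘ f₃.f) ≫ ((Y₁.p ⊗ₘ Y₂.p) ⊗ₘ Y₃.p) ≫ (α_ Y₁.X Y₂.X Y₃.X).hom =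
        (((X₁.p ⊗ₘ X₂.p) ⊗ₘ X₃.p) ≫ (α_ X₁.X X₂.X X₃.X).hom) ≫ (f₁.f ⊗ₘ (f₂.f ⊗ₘ f₃.f))
      simp only [assoc, ← associator_naturality, tensorHom_comp_tensorHom_assoc,
        tensorHom_comp_tensorHom, Karoubi.p_comp, Karoubi.comp_p])
    (leftUnitor_naturality := fun {X Y} f => by
      apply Karoubi.hom_ext
      change (𝟙 (𝟙_ C) ⊗ₘ f.f) ≫ (λ_ Y.X).hom ≫ Y.p = ((λ_ X.X).hom ≫ X.p) ≫ f.f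
      rw [id_tensorHom, leftUnitor_naturality_assoc]
      simp)
    (rightUnitor_naturality := fun {X Y} f => by
      apply Karoubi.hom_ext
      change (f.f ⊗ₘ 𝟙 (𝟙_ C)) ≫ (ρ_ Y.X).hom ≫ Y.p = ((ρ_ X.X).hom ≫ X.p) ≫ f.f
      rw [tensorHom_id, rightUnitor_naturality_assoc]
      simp)
    (pentagon := fun W X Y Z => by
      apply Karoubi.hom_ext
      change ((((W.p ⊗ₘ X.p) ⊗ₘ Y.p) ≫ (α_ W.X X.X Y.X).hom) ⊗ₘ Z.p) ≫
        (((W.p ⊗ₘ (X.p ⊗ₘ Y.p)) ⊗ₘ Z.p) ≫ (α_ W.X (X.X ⊗ Y.X) Z.X).hom) ≫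
          (W.p ⊗ₘ (((X.p ⊗ₘ Y.p) ⊗ₘ Z.p) ≫ (α_ X.X Y.X Z.X).hom)) =
        ((((W.p ⊗ₘ X.p) ⊗ₘ Y.p) ⊗ₘ Z.p) ≫ (α_ (W.X ⊗ X.X) Y.X Z.X).hom) ≫
          ((W.p ⊗ₘ X.p) ⊗ₘ (Y.p ⊗ₘ Z.p)) ≫ (α_ W.X X.X (Y.X ⊗ Z.X)).hom
      have h₁ : ((((W.p ⊗ₘ X.p) ⊗ₘ Y.p) ≫ (α_ W.X X.X Y.X).hom) ⊗ₘ Z.p) =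
          (((W.p ⊗ₘ X.p) ⊗ₘ Y.p) ⊗ₘ Z.p) ≫ (α_ W.X X.X Y.X).hom ▷ Z.X := by
        rw [← tensorHom_id, tensorHom_comp_tensorHom, comp_id]
      have h₂ : (W.p ⊗ₘ (((X.p ⊗ₘ Y.p) ⊗ₘ Z.p) ≫ (α_ X.X Y.X Z.X).hom)) =
          (W.p ⊗ₘ ((X.p ⊗ₘ Y.p) ⊗ₘ Z.p)) ≫ W.X ◁ (α_ X.X Y.X Z.X).hom := by
        rw [← id_tensorHom, tensorHom_comp_tensorHom, comp_id]
      have h₃ : (α_ W.X X.X Y.X).hom ▷ Z.X ≫ ((W.p ⊗ₘ (X.p ⊗ₘ Y.p)) ⊗ₘ Z.p) =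
          (((W.p ⊗ₘ X.p) ⊗ₘ Y.p) ⊗ₘ Z.p) ≫ (α_ W.X X.X Y.X).hom ▷ Z.X := by
        rw [← tensorHom_id, tensorHom_comp_tensorHom, tensorHom_comp_tensorHom, id_comp, comp_id,
          associator_naturality]
      rw [h₁, h₂]
      simp only [assoc, ← associator_naturality_assoc, reassoc_of% h₃,
        tensorHom_comp_tensorHom_assoc, tensorHom_comp_tensorHom, W.idem, X.idem, Y.idem, Z.idem,
        pentagon])
    (triangle := fun X Y => by
      apply Karoubi.hom_ext
      change (((X.p ⊗ₘ 𝟙 (𝟙_ C)) ⊗ₘ Y.p) ≫ (α_ X.X (𝟙_ C) Y.X).hom) ≫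
        (X.p ⊗ₘ ((λ_ Y.X).hom ≫ Y.p)) = ((ρ_ X.X).hom ≫ X.p) ⊗ₘ Y.p
      have h₁ : (X.p ⊗ₘ ((λ_ Y.X).hom ≫ Y.p)) = X.X ◁ (λ_ Y.X).hom ≫ (X.p ⊗ₘ Y.p) := by
        rw [← id_tensorHom, tensorHom_comp_tensorHom, id_comp]
      have h₂ : (((ρ_ X.X).hom ≫ X.p) ⊗ₘ Y.p) = (ρ_ X.X).hom ▷ Y.X ≫ (X.p ⊗ₘ Y.p) := by
        rw [← tensorHom_id, tensorHom_comp_tensorHom, id_comp]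
      have h₃ : ((X.p ⊗ₘ 𝟙 (𝟙_ C)) ⊗ₘ Y.p) ≫ (ρ_ X.X).hom ▷ Y.X =
          (ρ_ X.X).hom ▷ Y.X ≫ (X.p ⊗ₘ Y.p) := by
        rw [← tensorHom_id, tensorHom_comp_tensorHom, tensorHom_comp_tensorHom, id_comp, comp_id,
          tensorHom_id, rightUnitor_naturality]
      rw [h₁, h₂, assoc, triangle_assoc, reassoc_of% h₃, tensorHom_comp_tensorHom, X.idem, Y.idem])

/-- The embedding into the idempotent completion is a monoidal functor. -/
def toKaroubiCoreMonoidal : (toKaroubi C).CoreMonoidal where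
  εIso := Iso.refl _
  μIso X Y :=
    { hom := ⟨𝟙 (X ⊗ Y), by
        change (𝟙 X ⊗ₘ 𝟙 Y) ≫ 𝟙 _ ≫ 𝟙 _ = 𝟙 _
        simp⟩
      inv := ⟨𝟙 (X ⊗ Y), by
        change 𝟙 _ ≫ 𝟙 _ ≫ (𝟙 X ⊗ₘ 𝟙 Y) = 𝟙 _
        simp⟩
      hom_inv_id := by
        apply Karoubi.hom_ext
        change 𝟙 _ ≫ 𝟙 _ = 𝟙 X ⊗ₘ 𝟙 Y
        simp
      inv_hom_id := by
        apply Karoubi.hom_ext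
        change 𝟙 _ ≫ 𝟙 _ = 𝟙 (X ⊗ Y)
        simp }
  μIso_hom_natural_left {X Y} f X' := by
    apply Karoubi.hom_ext
    change (f ⊗ₘ 𝟙 X') ≫ 𝟙 _ = 𝟙 _ ≫ f ▷ X'
    simp
  μIso_hom_natural_right {X Y} X' f := by
    apply Karoubi.hom_ext
    change (𝟙 X' ⊗ₘ f) ≫ 𝟙 _ = 𝟙 _ ≫ X' ◁ f
    simp
  associativity X Y Z := by
    apply Karoubi.hom_ext
    change (𝟙 (X ⊗ Y) ⊗ₘ 𝟙 Z) ≫ 𝟙 _ ≫ (α_ X Y Z).hom =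
      (((𝟙 X ⊗ₘ 𝟙 Y) ⊗ₘ 𝟙 Z) ≫ (α_ X Y Z).hom) ≫ (𝟙 X ⊗ₘ 𝟙 (Y ⊗ Z)) ≫ 𝟙 _
    simp
  left_unitality X := by
    apply Karoubi.hom_ext
    change (λ_ X).hom ≫ 𝟙 X = (𝟙 (𝟙_ C) ⊗ₘ 𝟙 X) ≫ 𝟙 _ ≫ (λ_ X).hom
    simp
  right_unitality X := by
    apply Karoubi.hom_ext
    change (ρ_ X).hom ≫ 𝟙 X = (𝟙 X ⊗ₘ 𝟙 (𝟙_ C)) ≫ 𝟙 _ ≫ (ρ_ X).hom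
    simp

instance toKaroubiMonoidal : (toKaroubi C).Monoidal :=
  toKaroubiCoreMonoidal.toMonoidal

end Monoidal
end KaroubiEnvelope

namespace TensorTriangular

universe v u v' u'

section Spectrum

variable (K : Type u) [Category.{v} K] [HasZeroObject K] [Preadditive K] [HasShift K ℤ]
  [∀ n : ℤ, (shiftFunctor K n).Additive] [Pretriangulated K] [MonoidalCategory K]

/-- A tensor triangulated structure on a triangulated category with a (symmetric) monoidal
structure: the functors `a ⊗ -` and `- ⊗ b` are exact, where the isomorphisms
`a ⊗ T b ≅ T (a ⊗ b)` and `T a ⊗ b ≅ T (a ⊗ b)` are natural in both variables, and the two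
induced isomorphisms between `T a ⊗ T b` and `T (T (a ⊗ b))` differ by the sign `-1`. -/
class TensorTriangulated where
  commShift : (curriedTensor K).CommShift₂Int
  exact_left (a : K) : ((curriedTensor K).obj a).IsTriangulated
  exact_right (b : K) : ((curriedTensor K).flip.obj b).IsTriangulated

attribute [reducible] TensorTriangulated.commShift

attribute [instance] TensorTriangulated.commShift TensorTriangulated.exact_left
  TensorTriangulated.exact_right

/-- The natural morphism `D(a) ⊗ b ⟶ hom(a, b)`, where `D(a) = hom(a, 𝟙)`; it is adjoint to
the evaluation `a ⊗ (hom(a, 𝟙) ⊗ b) ⟶ b`. -/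
def dualTensorHom {K : Type u} [Category.{v} K] [MonoidalCategory K] [MonoidalClosed K]
    (a b : K) : (ihom a).obj (𝟙_ K) ⊗ b ⟶ (ihom a).obj b :=
  MonoidalClosed.curry
    ((α_ a ((ihom a).obj (𝟙_ K)) b).inv ≫ ((ihom.ev a).app (𝟙_ K) ▷ b) ≫ (λ_ b).hom)

section

open scoped Pretriangulated.Opposite

/-- A closed tensor triangulated category is strongly closed if the internal hom is exact in
each variable and every object is strongly dualizable. -/
class StronglyClosed [MonoidalClosed K] : Prop where
  exact_hom (a : K) : ∃ _ : (ihom a).CommShift ℤ, (ihom a).IsTriangulated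
  exact_hom_flip (c : K) :
    ∃ _ : ((MonoidalClosed.internalHom (C := K)).flip.obj c).CommShift ℤ,
      ((MonoidalClosed.internalHom (C := K)).flip.obj c).IsTriangulated
  stronglyDualizable (a b : K) : IsIso (dualTensorHom a b)

end

/-- Thick tensor ideals: full triangulated subcategories which are closed under direct
summands and under tensoring with arbitrary objects. -/
structure IsThickTensorIdeal (P : ObjectProperty K) : Prop where
  zero : P 0
  shift (a : K) : P (a⟦(1 : ℤ)⟧) ↔ P a
  cone (T : Triangle K) (hT : T ∈ distTriang K) : P T.obj₁ → P T.obj₂ → P T.obj₃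
  summand (a b : K) : P (a ⊞ b) → P a ∧ P b
  tensor (a b : K) : P a → P (a ⊗ b)

/-- The spectrum of a tensor triangulated category: the set of its prime ideals. -/
structure Spc where
  /-- the underlying full subcategory -/
  carrier : ObjectProperty K
  isThickTensorIdeal : IsThickTensorIdeal K carrier
  proper : ∃ a : K, ¬ carrier a
  prime (a b : K) : carrier (a ⊗ b) → carrier a ∨ carrier b

variable {K}

/-- The support of an object. -/
def supp (a : K) : Set (Spc K) := {P | ¬ P.carrier a}

/-- The Zariski topology: the complements of the supports of objects are a basis. -/
instance : TopologicalSpace (Spc K) :=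
  TopologicalSpace.generateFrom {U | ∃ a : K, U = (supp a)ᶜ}

/-- The objects supported on `Y`. -/
def supportedOn (Y : Set (Spc K)) : ObjectProperty K := fun a => supp a ⊆ Y

lemma IsThickTensorIdeal.of_iso {P : ObjectProperty K} (hP : IsThickTensorIdeal K P) {a b : K}
    (e : a ≅ b) (ha : P a) : P b := by
  have h : Triangle.mk (0 : (0 : K) ⟶ a) e.hom (0 : b ⟶ (0 : K)⟦(1 : ℤ)⟧) ∈ distTriang K := by
    refine isomorphic_distinguished _ (contractible_distinguished₁ a) _ ?_
    refine Triangle.isoMk _ _ (Iso.refl _) (Iso.refl _) e.symm ?_ ?_ ?_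
    · change (0 : (0 : K) ⟶ a) ≫ 𝟙 a = 𝟙 (0 : K) ≫ 0
      simp
    · change e.hom ≫ e.inv = 𝟙 a ≫ 𝟙 a
      simp
    · change (0 : b ⟶ (0 : K)⟦(1 : ℤ)⟧) ≫ (𝟙 (0 : K))⟦(1 : ℤ)⟧' = e.inv ≫ 0
      simp
  exact hP.cone _ h hP.zero ha

lemma IsThickTensorIdeal.shift_iff {P : ObjectProperty K} (hP : IsThickTensorIdeal K P) (a : K)
    (n : ℤ) : P (a⟦n⟧) ↔ P a := by
  have iso_iff {x y : K} (e : x ≅ y) : P x ↔ P y := ⟨hP.of_iso e, hP.of_iso e.symm⟩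
  induction n with
  | zero => exact iso_iff ((shiftFunctorZero K ℤ).app a)
  | succ n ih =>
    exact (iso_iff ((shiftFunctorAdd K (n : ℤ) 1).app a)).trans
      ((hP.shift (a⟦(n : ℤ)⟧)).trans ih)
  | pred n ih =>
    exact (hP.shift (a⟦(-(n : ℤ) - 1)⟧)).symm.trans
      ((iso_iff ((shiftFunctorAdd' K (-(n : ℤ) - 1) 1 (-n) (by lia)).app a)).symm.trans ih)

instance (Y : Set (Spc K)) : (supportedOn Y).IsClosedUnderIsomorphisms where
  of_iso e h P hP := h fun ha => hP (P.isThickTensorIdeal.of_iso e ha)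

instance (Y : Set (Spc K)) : (supportedOn Y).IsTriangulated where
  toContainsZero := ⟨0, isZero_zero K, fun P hP => (hP P.isThickTensorIdeal.zero).elim⟩
  toIsStableUnderShift := ⟨fun n => ⟨fun a ha P hP =>
    ha fun h => hP ((P.isThickTensorIdeal.shift_iff a n).2 h)⟩⟩
  toIsTriangulatedClosed₂ := .mk' fun T hT h₁ h₃ P hP => by
    by_contra hY
    refine hP (P.isThickTensorIdeal.cone _ (inv_rot_of_distTriang _ hT) ?_ ?_)
    · exact (P.isThickTensorIdeal.shift_iff _ _).2 (not_not.1 fun h => hY (h₃ h))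
    · exact not_not.1 fun h => hY (h₁ h)

/-- A tensor triangulated functor `F : K ⥤ L` induces the map `P ↦ F⁻¹(P)` on spectra. -/
def Spc.comap {L : Type u'} [Category.{v'} L] [HasZeroObject L] [Preadditive L] [HasShift L ℤ]
    [∀ n : ℤ, (shiftFunctor L n).Additive] [Pretriangulated L] [MonoidalCategory L]
    (F : K ⥤ L) [F.CommShift ℤ] [F.IsTriangulated] [F.Monoidal] (P : Spc L) : Spc K where
  carrier := P.carrier.inverseImage F
  isThickTensorIdeal :=
    { zero := P.isThickTensorIdeal.of_iso F.mapZeroObject.symm P.isThickTensorIdeal.zero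
      shift a :=
        Iff.trans ⟨P.isThickTensorIdeal.of_iso ((F.commShiftIso (1 : ℤ)).app a),
          P.isThickTensorIdeal.of_iso ((F.commShiftIso (1 : ℤ)).app a).symm⟩
          (P.isThickTensorIdeal.shift (F.obj a))
      cone T hT := P.isThickTensorIdeal.cone _ (F.map_distinguished T hT)
      summand a b h :=
        have := preservesBinaryBiproducts_of_preservesBiproducts F
        P.isThickTensorIdeal.summand _ _ (P.isThickTensorIdeal.of_iso (F.mapBiprod a b) h)
      tensor a b h := P.isThickTensorIdeal.of_iso (Functor.Monoidal.μIso F a b)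
        (P.isThickTensorIdeal.tensor _ _ h) }
  proper := by
    by_contra! h
    obtain ⟨a, ha⟩ := P.proper
    exact ha (P.isThickTensorIdeal.of_iso (λ_ a) (P.isThickTensorIdeal.tensor _ _
      (P.isThickTensorIdeal.of_iso (Functor.Monoidal.εIso F).symm (h (𝟙_ K)))))
  prime a b h := P.prime _ _ (P.isThickTensorIdeal.of_iso (Functor.Monoidal.μIso F a b).symm h)

end Spectrum

section Restriction

variable {K : Type u} [Category.{v} K] [HasZeroObject K] [Preadditive K] [HasShift K ℤ]
  [∀ n : ℤ, (shiftFunctor K n).Additive] [Pretriangulated K] [IsTriangulated K]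
  [MonoidalCategory K] [SymmetricCategory K] [TensorTriangulated K]

instance (Y : Set (Spc K)) : (supportedOn Y).trW.IsMonoidal where
  whiskerLeft X _ _ f := by
    rintro ⟨Z, g, h, hT, hZ⟩
    refine ⟨_, _, _, ((curriedTensor K).obj X).map_distinguished _ hT, fun P hP => hZ fun h => ?_⟩
    exact hP (P.isThickTensorIdeal.of_iso (β_ Z X) (P.isThickTensorIdeal.tensor _ _ h))
  whiskerRight f := by
    rintro ⟨Z, g, h, hT, hZ⟩ Y
    refine ⟨_, _, _, ((curriedTensor K).flip.obj Y).map_distinguished _ hT,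
      fun P hP => hZ fun h => ?_⟩
    exact hP (P.isThickTensorIdeal.tensor _ _ h)

/-- The tensor product on the Verdier quotient of `K` by the objects supported on `Z`. -/
instance quotientMonoidal (Z : Set (Spc K)) : MonoidalCategory (supportedOn Z).trW.Localization :=
  inferInstanceAs (MonoidalCategory (LocalizedMonoidal (supportedOn Z).trW.Q
    (supportedOn Z).trW (Iso.refl ((supportedOn Z).trW.Q.obj (𝟙_ K)))))

instance quotientFunctorMonoidal (Z : Set (Spc K)) : (supportedOn Z).trW.Q.Monoidal :=
  inferInstanceAs (Localization.Monoidal.toMonoidalCategory (supportedOn Z).trW.Q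
    (supportedOn Z).trW (Iso.refl ((supportedOn Z).trW.Q.obj (𝟙_ K)))).Monoidal

/-- The category `K(U)`: the idempotent completion of the Verdier quotient of `K` by the objects
supported on the complement of `U`. -/
abbrev KU (U : Set (Spc K)) := Karoubi (supportedOn Uᶜ).trW.Localization

/-- The restriction functor `ρ : K ⥤ K(U)`. -/
abbrev restriction (U : Set (Spc K)) : K ⥤ KU U :=
  (supportedOn Uᶜ).trW.Q ⋙ toKaroubi _

/-- The objects of `K(U)` supported on `Y ⊆ Spc K`, that is, those whose support in `Spc (K(U))`
is mapped into `Y` by the map `Spc (K(U)) → Spc K` induced by the restriction functor. -/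
def supportedOnKU (U Y : Set (Spc K)) : ObjectProperty (KU U) :=
  supportedOn (Spc.comap (restriction U) ⁻¹' Y)

lemma restriction_supportedOn (U Y : Set (Spc K)) (a : (supportedOn Y).FullSubcategory) :
    supportedOnKU U Y (((supportedOn Y).ι ⋙ restriction U).obj a) :=
  fun P hP => a.property (show ¬ (Spc.comap (restriction U) P).carrier a.obj from hP)

/-- The functor from the objects of `K` supported on `Y` to the objects of `K(U)` supported
on `Y` which is induced by restriction. -/
def restrictionOn (U Y : Set (Spc K)) :
    (supportedOn Y).FullSubcategory ⥤ (supportedOnKU U Y).FullSubcategory :=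
  (supportedOnKU U Y).lift ((supportedOn Y).ι ⋙ restriction U) (restriction_supportedOn U Y)

end Restriction

end TensorTriangular

end

universe w v u

/-! Write `Z = Uᶜ`. By strong duality every `a` is a direct summand of `a ⊗ D(a) ⊗ a`, so every
thick tensor ideal is radical and hence an intersection of primes (`exists_prime`). In particular an
object with empty support is zero. A morphism `a ⟶ b` factors through `a ⊗ D(a) ⊗ b`, so it vanishes
when the supports of `a` and `b` are disjoint.

Full faithfulness: if `x` is supported in `U`, it has no nonzero morphism to an object supported on
`Z`, so fractions out of `x` become honest morphisms, uniquely (`restriction_map_bijective`).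

Essential surjectivity: an object `b` of `K(U)` need not come from `K`, but the cone of `1 - p`, for
the idempotent `p` defining `b`, does. This gives `z` in `K` such that `b` is a retract of `ρ(z)`
and `ρ(z)` is a retract of `b ⊞ b⟦1⟧`. Primes in `U` extend to `K(U)`, so if `b` is supported on `Y`
then `supp z ⊆ Y ∪ Z` (`supp_subset_of_retract`). The objects of `K` whose restriction is a retract
of some `ρ(c)` with `c` supported on `Y` form a thick tensor ideal containing everything supported
on `Y` or on `Z`; since ideals are intersections of primes, it contains `z`
(`imageRetracts_restriction_of_supp_subset`). So `b` is a retract of such a `ρ(c)`; its idempotent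
lifts to `c` by full faithfulness and splits in `K`. -/

namespace TensorTriangular

/-! ### Closure properties of thick tensor ideals -/

section Ideals

variable {K : Type u} [Category.{v} K] [HasZeroObject K] [Preadditive K] [HasShift K ℤ]
  [∀ n : ℤ, (shiftFunctor K n).Additive] [Pretriangulated K] [MonoidalCategory K]
  {P : ObjectProperty K}

namespace IsThickTensorIdeal

lemma isClosedUnderIsomorphisms (hP : IsThickTensorIdeal K P) : P.IsClosedUnderIsomorphisms where
  of_iso e h := hP.of_iso e h

lemma isTriangulated (hP : IsThickTensorIdeal K P) : P.IsTriangulated :=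
  have := hP.isClosedUnderIsomorphisms
  { toContainsZero := ⟨0, isZero_zero K, hP.zero⟩
    toIsStableUnderShift := ⟨fun n => ⟨fun a ha => (hP.shift_iff a n).2 ha⟩⟩
    toIsTriangulatedClosed₂ := .mk' fun _ hT h₁ h₃ =>
      hP.cone _ (inv_rot_of_distTriang _ hT) ((hP.shift_iff _ _).2 h₃) h₁ }

lemma of_isZero (hP : IsThickTensorIdeal K P) {a : K} (ha : IsZero a) : P a :=
  hP.of_iso ha.isoZero.symm hP.zero

lemma biprod (hP : IsThickTensorIdeal K P) {a b : K} (ha : P a) (hb : P b) : P (a ⊞ b) := by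
  have := hP.isClosedUnderIsomorphisms
  have := hP.isTriangulated
  exact P.ext_of_isTriangulatedClosed₂ _ (binaryBiproductTriangle_distinguished a b) ha hb

/-- A split monomorphism has a cone with zero connecting morphism, so a retract is a biproduct
summand. -/
lemma of_retract (hP : IsThickTensorIdeal K P) {a b : K} (r : Retract a b) (hb : P b) : P a := by
  obtain ⟨c, g, h, hT⟩ := distinguished_cocone_triangle r.i
  have hg : h = 0 := by
    have h₁ : h ≫ r.i⟦(1 : ℤ)⟧' = 0 := comp_distTriang_mor_zero₃₁ _ hT
    rw [← comp_id h, ← (shiftFunctor K (1 : ℤ)).map_id a, ← r.retract, Functor.map_comp,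
      reassoc_of% h₁, zero_comp]
  obtain ⟨e, -⟩ := exists_iso_binaryBiproduct_of_distTriang _ hT hg
  exact (hP.summand _ _ (hP.of_iso e hb)).1

end IsThickTensorIdeal

lemma isThickTensorIdeal_isZero
    (htensor : ∀ (a b : K), IsZero a → IsZero (a ⊗ b)) :
    IsThickTensorIdeal K (fun a : K => IsZero a) where
  zero := isZero_zero K
  shift a := ⟨fun h => ((shiftFunctor K (-1 : ℤ)).map_isZero h).of_iso
    (shiftShiftNeg a (1 : ℤ)).symm, fun h => (shiftFunctor K (1 : ℤ)).map_isZero h⟩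
  cone T hT h₁ h₂ := T.isZero₃_of_isZero₁₂ hT h₁ h₂
  summand a b h := ⟨h.of_mono (biprod.inl : a ⟶ a ⊞ b), h.of_mono (biprod.inr : b ⟶ a ⊞ b)⟩
  tensor := htensor

end Ideals

/-! ### Duality and the splitting of evaluation -/

section Rigid

variable {K : Type u} [Category.{v} K] [MonoidalCategory K] [MonoidalClosed K]

/-- The retraction `a ⊗ (D(a) ⊗ x) ⟶ x` given by evaluation. -/
def evTensor (a x : K) : a ⊗ ((ihom a).obj (𝟙_ K) ⊗ x) ⟶ x :=
  (α_ a ((ihom a).obj (𝟙_ K)) x).inv ≫ ((ihom.ev a).app (𝟙_ K) ▷ x) ≫ (λ_ x).hom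

lemma evTensor_naturality (a : K) {x y : K} (f : x ⟶ y) :
    a ◁ (_ ◁ f) ≫ evTensor a y = evTensor a x ≫ f := by
  simp only [evTensor, assoc, associator_inv_naturality_right_assoc, whisker_exchange_assoc,
    Functor.id_obj, leftUnitor_naturality]

/-- The section is `a` tensored with a coevaluation `𝟙 ⟶ D(a) ⊗ a`, which is the name of the
identity in `hom(a, a)` transported along the inverse of `dualTensorHom a a`. -/
lemma exists_section_evTensor (a : K) [IsIso (dualTensorHom a a)] :
    ∃ s : a ⟶ a ⊗ ((ihom a).obj (𝟙_ K) ⊗ a), s ≫ evTensor a a = 𝟙 a := by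
  refine ⟨(ρ_ a).inv ≫ a ◁ (MonoidalClosed.curry (ρ_ a).hom ≫ inv (dualTensorHom a a)), ?_⟩
  have h : evTensor a a = MonoidalClosed.uncurry (dualTensorHom a a) := by
    rw [dualTensorHom, MonoidalClosed.uncurry_curry, evTensor]
  rw [h, assoc, ← MonoidalClosed.uncurry_natural_left, assoc, IsIso.inv_hom_id, comp_id,
    MonoidalClosed.uncurry_curry, Iso.inv_hom_id]

end Rigid

/-! ### Calculus of supports -/

section Spectrum

variable {K : Type u} [Category.{v} K] [HasZeroObject K] [Preadditive K] [HasShift K ℤ]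
  [∀ n : ℤ, (shiftFunctor K n).Additive] [Pretriangulated K]
  [MonoidalCategory K]

lemma supp_biprod (a b : K) : supp (a ⊞ b) = supp a ∪ supp b := by
  ext P
  simp only [supp, Set.mem_ofPred_eq, Set.mem_union, ← not_and_or]
  exact not_congr ⟨P.isThickTensorIdeal.summand a b, fun h => P.isThickTensorIdeal.biprod h.1 h.2⟩

lemma supp_eq_empty_of_isZero {a : K} (ha : IsZero a) : supp a = ∅ :=
  Set.eq_empty_of_forall_notMem fun P hP => hP (P.isThickTensorIdeal.of_isZero ha)

lemma supp_tensorUnit : supp (𝟙_ K) = Set.univ := by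
  refine Set.eq_univ_of_forall fun P hP => ?_
  obtain ⟨a, ha⟩ := P.proper
  exact ha (P.isThickTensorIdeal.of_iso (λ_ a) (P.isThickTensorIdeal.tensor _ _ hP))

variable (K) in
lemma isTopologicalBasis_compl_supp :
    TopologicalSpace.IsTopologicalBasis {V : Set (Spc K) | ∃ a : K, V = (supp a)ᶜ} where
  exists_subset_inter := by
    rintro _ ⟨a, rfl⟩ _ ⟨b, rfl⟩ P hP
    refine ⟨_, ⟨a ⊞ b, rfl⟩, ?_, ?_⟩ <;> rw [supp_biprod, Set.compl_union]
    exact hP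
  sUnion_eq := Set.eq_univ_of_forall fun P =>
    ⟨_, ⟨0, rfl⟩, by simp [supp_eq_empty_of_isZero (isZero_zero K)]⟩
  eq_generateFrom := rfl

variable [SymmetricCategory K]

lemma IsThickTensorIdeal.tensor_left {P : ObjectProperty K} (hP : IsThickTensorIdeal K P)
    (a b : K) (hb : P b) : P (a ⊗ b) :=
  hP.of_iso (β_ b a) (hP.tensor b a hb)

lemma supp_tensor (a b : K) : supp (a ⊗ b) = supp a ∩ supp b := by
  ext P
  simp only [supp, Set.mem_ofPred_eq, Set.mem_inter_iff, ← not_or]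
  refine not_congr ⟨P.prime a b, ?_⟩
  rintro (h | h)
  · exact P.isThickTensorIdeal.tensor _ _ h
  · exact P.isThickTensorIdeal.tensor_left _ _ h

lemma isThickTensorIdeal_supportedOn (Y : Set (Spc K)) :
    IsThickTensorIdeal K (supportedOn Y) where
  zero := (supportedOn Y).prop_zero
  shift a := (supportedOn Y).prop_shift_iff_of_isStableUnderShift a 1
  cone T hT h₁ h₂ := (supportedOn Y).ext_of_isTriangulatedClosed₃ T hT h₁ h₂
  summand a b h := by
    rw [supportedOn, supp_biprod, Set.union_subset_iff] at h
    exact h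
  tensor a b h := by
    rw [supportedOn, supp_tensor]
    exact Set.inter_subset_left.trans h

/-- A closed subset with quasi-compact complement is the support of an object. -/
lemma exists_supp_eq {Y : Set (Spc K)} (hY : IsClosed Y) (hY' : IsCompact Yᶜ) :
    ∃ a : K, supp a = Y := by
  -- The complement of `Y` is a finite union of basic opens, so `Y` is a finite intersection of
  -- supports, that is, the support of a finite tensor product (the unit if the family is empty).
  obtain ⟨s, hs, h⟩ := eq_finite_iUnion_of_isTopologicalBasis_of_isCompact_open
    (fun a : K => (supp a)ᶜ) (by
      convert isTopologicalBasis_compl_supp K using 1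
      ext V
      simp [eq_comm]) Yᶜ hY' hY.isOpen_compl
  have hs' : ∃ a : K, supp a = ⋂ i ∈ s, supp i := by
    clear h
    induction s, hs using Set.Finite.induction_on with
    | empty => exact ⟨𝟙_ K, by simp [supp_tensorUnit]⟩
    | @insert b s _ _ ih =>
      obtain ⟨a, ha⟩ := ih
      exact ⟨b ⊗ a, by rw [supp_tensor, ha, Set.biInter_insert]⟩
  obtain ⟨a, ha⟩ := hs'
  refine ⟨a, ?_⟩
  rw [ha, ← compl_inj_iff, h]
  simp

end Spectrum

/-! ### Ideals are radical -/

section Radical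

variable {K : Type u} [Category.{v} K] [HasZeroObject K] [Preadditive K] [HasShift K ℤ]
  [∀ n : ℤ, (shiftFunctor K n).Additive] [Pretriangulated K]
  [MonoidalCategory K] [MonoidalClosed K] [StronglyClosed K]

instance (a b : K) : IsIso (dualTensorHom a b) := StronglyClosed.stronglyDualizable a b

variable [SymmetricCategory K]

/-- `a` is a summand of `a ⊗ (D(a) ⊗ a)`, which up to symmetry is a multiple of `a ⊗ a`. -/
lemma IsThickTensorIdeal.radical {P : ObjectProperty K} (hP : IsThickTensorIdeal K P) {a : K}
    (h : P (a ⊗ a)) : P a := by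
  obtain ⟨s, hs⟩ := exists_section_evTensor a
  refine hP.of_retract ⟨s, evTensor a a, hs⟩ ?_
  exact hP.of_iso ((α_ _ _ _) ≪≫ whiskerLeftIso a (β_ _ _)) (hP.tensor _ ((ihom a).obj (𝟙_ K)) h)

end Radical

/-! ### Existence of primes, and vanishing of objects and morphisms by support -/

section Existence

variable {K : Type u} [Category.{v} K] [HasZeroObject K] [Preadditive K] [HasShift K ℤ]
  [∀ n : ℤ, (shiftFunctor K n).Additive] [Pretriangulated K]
  [MonoidalCategory K] [TensorTriangulated K]

lemma isZero_tensor_right {a : K} (b : K) (ha : IsZero a) : IsZero (a ⊗ b) :=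
  ((curriedTensor K).flip.obj b).map_isZero ha

variable [SymmetricCategory K]

/-- The ideal `{c | c ⊗ y ∈ P}`. -/
lemma IsThickTensorIdeal.colon {P : ObjectProperty K} (hP : IsThickTensorIdeal K P) (y : K) :
    IsThickTensorIdeal K (fun c => P (c ⊗ y)) where
  zero := hP.of_isZero (isZero_tensor_right y (isZero_zero K))
  shift a := Iff.trans
    ⟨hP.of_iso ((((curriedTensor K).flip.obj y).commShiftIso (1 : ℤ)).app a),
      hP.of_iso ((((curriedTensor K).flip.obj y).commShiftIso (1 : ℤ)).app a).symm⟩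
    (hP.shift (a ⊗ y))
  cone T hT h₁ h₂ := hP.cone _ (((curriedTensor K).flip.obj y).map_distinguished _ hT) h₁ h₂
  summand a b h :=
    ⟨hP.of_retract (Retract.map ⟨biprod.inl, biprod.fst, by simp⟩
        ((curriedTensor K).flip.obj y)) h,
      hP.of_retract (Retract.map ⟨biprod.inr, biprod.snd, by simp⟩
        ((curriedTensor K).flip.obj y)) h⟩
  tensor a b h := hP.of_iso (α_ a y b ≪≫ whiskerLeftIso a (β_ y b) ≪≫ (α_ a b y).symm)
    (hP.tensor _ b h)

variable [MonoidalClosed K] [StronglyClosed K]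

/-- Thick tensor ideals of a strongly closed tensor triangulated category are
intersections of primes. -/
lemma IsThickTensorIdeal.exists_prime {I : ObjectProperty K} (hI : IsThickTensorIdeal K I)
    {a : K} (ha : ¬ I a) : ∃ P : Spc K, I ≤ P.carrier ∧ ¬ P.carrier a := by
  -- Avoiding `a` alone, rather than all its tensor powers, is enough because ideals are radical.
  obtain ⟨P, hIP, hP⟩ := zorn_le_nonempty₀
    {J : ObjectProperty K | IsThickTensorIdeal K J ∧ ¬ J a} (fun c hc hchain J₀ hJ₀ => by
      refine ⟨fun x => ∃ J ∈ c, J x, ⟨?_, ?_⟩, fun J hJ x hx => ⟨J, hJ, hx⟩⟩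
      · exact
          { zero := ⟨J₀, hJ₀, (hc hJ₀).1.zero⟩
            shift x := ⟨fun ⟨J, hJ, h⟩ => ⟨J, hJ, ((hc hJ).1.shift x).1 h⟩,
              fun ⟨J, hJ, h⟩ => ⟨J, hJ, ((hc hJ).1.shift x).2 h⟩⟩
            cone := by
              rintro T hT ⟨J₁, hJ₁, h₁⟩ ⟨J₂, hJ₂, h₂⟩
              obtain h | h := hchain.total hJ₁ hJ₂
              · exact ⟨J₂, hJ₂, (hc hJ₂).1.cone T hT (h _ h₁) h₂⟩
              · exact ⟨J₁, hJ₁, (hc hJ₁).1.cone T hT h₁ (h _ h₂)⟩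
            summand := fun x y ⟨J, hJ, h⟩ => ⟨⟨J, hJ, ((hc hJ).1.summand x y h).1⟩,
              ⟨J, hJ, ((hc hJ).1.summand x y h).2⟩⟩
            tensor := fun x y ⟨J, hJ, h⟩ => ⟨J, hJ, (hc hJ).1.tensor x y h⟩ }
      · rintro ⟨J, hJ, h⟩
        exact (hc hJ).2 h) I ⟨hI, ha⟩
  have hP' : IsThickTensorIdeal K P := hP.prop.1
  have key (J : ObjectProperty K) (hJ : IsThickTensorIdeal K J) (hPJ : P ≤ J) (x : K) (hx : J x)
      (hx' : ¬ P x) : J a := by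
    by_contra h
    exact hx' (hP.le_of_ge ⟨hJ, h⟩ hPJ x hx)
  refine ⟨⟨P, hP', ⟨a, hP.prop.2⟩, fun x y hxy => ?_⟩, hIP, hP.prop.2⟩
  by_contra! h
  -- By maximality any ideal strictly larger than `P` contains `a`. This applies to `(P : y)`, which
  -- contains `x`, and then to `(P : a)`, which contains `y`.
  have h₁ : P (a ⊗ y) := key _ (hP'.colon y) (fun b hb => hP'.tensor b y hb) x hxy h.1
  have h₂ : P (a ⊗ a) := key _ (hP'.colon a) (fun b hb => hP'.tensor b a hb) y
    (hP'.of_iso (β_ _ _) h₁) h.2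
  exact hP.prop.2 (hP'.radical h₂)

lemma isZero_of_supp_eq_empty {a : K} (ha : supp a = ∅) : IsZero a := by
  by_contra h
  obtain ⟨P, -, hP⟩ := (isThickTensorIdeal_isZero
    (fun a b h => isZero_tensor_right (K := K) b h)).exists_prime h
  exact Set.notMem_empty P (ha ▸ hP)

/-- There are no nonzero morphisms between objects with disjoint supports. -/
lemma eq_zero_of_disjoint_supp {a b : K} (h : Disjoint (supp a) (supp b)) (f : a ⟶ b) :
    f = 0 := by
  obtain ⟨s, hs⟩ := exists_section_evTensor a
  have h₀ : IsZero (a ⊗ ((ihom a).obj (𝟙_ K) ⊗ b)) := by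
    apply isZero_of_supp_eq_empty
    rw [supp_tensor, supp_tensor, Set.inter_left_comm, h.inter_eq, Set.inter_empty]
  -- Insert `s ≫ evTensor a a = 𝟙 a` before `f`; naturality of evaluation makes `f` factor through
  -- the zero object of `h₀`.
  rw [← id_comp f, ← hs, assoc, ← evTensor_naturality, h₀.eq_zero_of_src (evTensor a b), comp_zero,
    comp_zero]

end Existence

/-- Two retracts which define the same idempotent are isomorphic. -/
def retractIsoOfEq {C : Type u} [Category.{v} C] {X X' Y : C} (r : Retract X Y)
    (r' : Retract X' Y) (h : r.r ≫ r.i = r'.r ≫ r'.i) : X ≅ X' where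
  hom := r.i ≫ r'.r
  inv := r'.i ≫ r.r
  hom_inv_id := by
    rw [assoc, ← reassoc_of% h, r.retract_assoc, r.retract]
  inv_hom_id := by
    rw [assoc, reassoc_of% h, r'.retract_assoc, r'.retract]

/-! ### Retracts of images of a functor, and the cone of an idempotent -/

section ImageRetracts

universe v' u'

variable {C : Type u} [Category.{v} C] {D : Type u'} [Category.{v'} D]

/-- The retracts of the images under `F` of the objects which satisfy `S`. -/
def imageRetracts (F : C ⥤ D) (S : ObjectProperty C) : ObjectProperty D :=
  fun d => ∃ c, S c ∧ Nonempty (Retract d (F.obj c))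

variable {F : C ⥤ D} {S : ObjectProperty C}

lemma imageRetracts_of_retract {d d' : D} (r : Retract d d') (h : imageRetracts F S d') :
    imageRetracts F S d := by
  obtain ⟨c, hc, ⟨r'⟩⟩ := h
  exact ⟨c, hc, ⟨r.trans r'⟩⟩

lemma imageRetracts_obj {c : C} (hc : S c) : imageRetracts F S (F.obj c) :=
  ⟨c, hc, ⟨Retract.refl _⟩⟩

lemma imageRetracts_shift [HasShift C ℤ] [HasShift D ℤ] [F.CommShift ℤ] (hS : ∀ (c : C) (n : ℤ), S c → S (c⟦n⟧)) (d : D) :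
    imageRetracts F S (d⟦(1 : ℤ)⟧) ↔ imageRetracts F S d := by
  have aux (d : D) (n : ℤ) (h : imageRetracts F S d) : imageRetracts F S (d⟦n⟧) := by
    obtain ⟨c, hc, ⟨r⟩⟩ := h
    exact ⟨_, hS c n hc,
      ⟨(r.map (shiftFunctor D n)).trans (.ofIso ((F.commShiftIso n).app c).symm)⟩⟩
  exact ⟨fun h => imageRetracts_of_retract (.ofIso (shiftShiftNeg d (1 : ℤ)).symm) (aux _ (-1) h),
    aux d 1⟩

variable [HasZeroObject C] [Preadditive C] [HasShift C ℤ]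
  [∀ n : ℤ, (shiftFunctor C n).Additive] [Pretriangulated C]
  [HasZeroObject D] [Preadditive D] [HasShift D ℤ]
  [∀ n : ℤ, (shiftFunctor D n).Additive] [Pretriangulated D]

/-- `H` lifts morphisms between images, up to changing the target. It will be supplied once by
calculus of fractions and once by full faithfulness on objects supported in `U`. -/
lemma imageRetracts_cone [F.CommShift ℤ] [F.IsTriangulated]
    (hS : ∀ T ∈ distTriang C, S T.obj₁ → S T.obj₂ → S T.obj₃)
    (H : ∀ (x y : C) (g : F.obj x ⟶ F.obj y), S x → S y →
      ∃ (y' : C) (f : x ⟶ y') (e : F.obj y ≅ F.obj y'), S y' ∧ g ≫ e.hom = F.map f)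
    (T : Triangle D) (hT : T ∈ distTriang D)
    (h₁ : imageRetracts F S T.obj₁) (h₂ : imageRetracts F S T.obj₂) :
    imageRetracts F S T.obj₃ := by
  obtain ⟨x, hx, ⟨r₁⟩⟩ := h₁
  obtain ⟨y, hy, ⟨r₂⟩⟩ := h₂
  obtain ⟨y', f, e, hy', he⟩ := H x y (r₁.r ≫ T.mor₁ ≫ r₂.i) hx hy
  obtain ⟨z, g, h, hT'⟩ := distinguished_cocone_triangle f
  refine ⟨z, hS _ hT' hx hy', ?_⟩
  have hFT := F.map_distinguished _ hT'
  have hc₁ : T.mor₁ ≫ r₂.i ≫ e.hom = r₁.i ≫ F.map f := by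
    rw [← he, assoc, assoc, r₁.retract_assoc]
  have hc₂ : F.map f ≫ e.inv ≫ r₂.r = r₁.r ≫ T.mor₁ := by
    simp [← reassoc_of% he]
  let φ := completeDistinguishedTriangleMorphism T _ hT hFT r₁.i (r₂.i ≫ e.hom) hc₁
  let ψ := completeDistinguishedTriangleMorphism _ T hFT hT r₁.r (e.inv ≫ r₂.r) hc₂
  have h₁ : (φ ≫ ψ).hom₁ = 𝟙 _ := r₁.retract
  have h₂ : (φ ≫ ψ).hom₂ = 𝟙 _ := by
    change (r₂.i ≫ e.hom) ≫ e.inv ≫ r₂.r = 𝟙 _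
    simp
  -- Completions to morphisms of triangles are not unique, so the third component is only an
  -- isomorphism; composing with its inverse corrects the retraction.
  have : IsIso (φ ≫ ψ).hom₃ := isIso₃_of_isIso₁₂ _ hT hT (by rw [h₁]; infer_instance)
    (by rw [h₂]; infer_instance)
  exact ⟨⟨φ.hom₃, ψ.hom₃ ≫ inv (φ ≫ ψ).hom₃,
    (assoc _ _ _).symm.trans (IsIso.hom_inv_id (φ ≫ ψ).hom₃)⟩⟩

/-- If `b` is a retract of `x` with associated idempotent `p`, the cone of `1 - p` is
isomorphic to `b ⊞ b⟦1⟧`; only the following weaker fact is needed. -/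
lemma retract_cone {b x z : D} (r : Retract b x) {g : x ⟶ z} {h : z ⟶ x⟦(1 : ℤ)⟧}
    (hT : Triangle.mk (𝟙 x - r.r ≫ r.i) g h ∈ distTriang D) :
    Nonempty (Retract b z) ∧ Nonempty (Retract z (b ⊞ b⟦(1 : ℤ)⟧)) := by
  obtain ⟨p, hp⟩ : ∃ p, p = r.r ≫ r.i := ⟨_, rfl⟩
  have hpp : p ≫ p = p := by simp [hp]
  have hpi : r.i ≫ p = r.i := by simp [hp]
  have hpr : p ≫ r.r = r.r := by simp [hp]
  rw [← hp] at hT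
  obtain ⟨s, hs⟩ : ∃ s : z ⟶ x, p = g ≫ s := Triangle.yoneda_exact₂ _ hT p (by
    change (𝟙 x - p) ≫ p = 0
    rw [Preadditive.sub_comp, id_comp, hpp, sub_self])
  obtain ⟨t, ht⟩ : ∃ t : x⟦(1 : ℤ)⟧ ⟶ z, p⟦(1 : ℤ)⟧' = t ≫ h :=
    Triangle.coyoneda_exact₁ _ hT (p⟦(1 : ℤ)⟧') (by
      change p⟦(1 : ℤ)⟧' ≫ (𝟙 x - p)⟦(1 : ℤ)⟧' = 0
      rw [← Functor.map_comp, Preadditive.comp_sub, comp_id, hpp, sub_self, Functor.map_zero])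
  have hpg : p ≫ g = g := by
    have : (𝟙 x - p) ≫ g = 0 := comp_distTriang_mor_zero₁₂ _ hT
    rwa [Preadditive.sub_comp, id_comp, sub_eq_zero, eq_comm] at this
  have hhp : h ≫ p⟦(1 : ℤ)⟧' = h := by
    have : h ≫ (𝟙 x - p)⟦(1 : ℤ)⟧' = 0 := comp_distTriang_mor_zero₃₁ _ hT
    rwa [Functor.map_sub, CategoryTheory.Functor.map_id, Preadditive.comp_sub, comp_id, sub_eq_zero,
      eq_comm] at this
  have hgh : g ≫ h = 0 := comp_distTriang_mor_zero₂₃ _ hT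
  refine ⟨⟨⟨r.i ≫ g, s ≫ r.r, ?_⟩⟩, ?_⟩
  · rw [assoc, ← reassoc_of% hs, reassoc_of% hpi, r.retract]
  -- Since `s` and `t` are chosen independently, `φ` need not be the identity. It is an endomorphism
  -- of the triangle with identities on `x`, hence invertible, and it factors through `b ⊞ b⟦1⟧`.
  · let φ : z ⟶ z := s ≫ g + h ≫ t
    have hφ : IsIso φ := isIso₃_of_isIso₁₂ (Triangle.homMk (Triangle.mk (𝟙 x - p) g h)
      (Triangle.mk (𝟙 x - p) g h) (𝟙 x) (𝟙 x) φ
      (by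
        change (𝟙 x - p) ≫ 𝟙 x = 𝟙 x ≫ (𝟙 x - p)
        rw [comp_id, id_comp])
      (by
        change g ≫ φ = 𝟙 x ≫ g
        simp only [φ, Preadditive.comp_add, reassoc_of% hgh, zero_comp, add_zero, id_comp,
          ← reassoc_of% hs, hpg])
      (by
        change h ≫ (𝟙 x)⟦(1 : ℤ)⟧' = φ ≫ h
        simp only [φ, Preadditive.add_comp, assoc, hgh, comp_zero, zero_add, ← ht, hhp,
          CategoryTheory.Functor.map_id, comp_id])) hT hT (IsIso.id x) (IsIso.id x)
    refine ⟨⟨biprod.lift (s ≫ r.r) (h ≫ r.r⟦(1 : ℤ)⟧'),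
      biprod.desc (r.i ≫ g) (r.i⟦(1 : ℤ)⟧' ≫ t) ≫ inv φ, ?_⟩⟩
    rw [biprod.lift_desc_assoc]
    have : (s ≫ r.r) ≫ r.i ≫ g + (h ≫ r.r⟦(1 : ℤ)⟧') ≫ r.i⟦(1 : ℤ)⟧' ≫ t = φ := by
      have : r.r⟦(1 : ℤ)⟧' ≫ r.i⟦(1 : ℤ)⟧' = p⟦(1 : ℤ)⟧' := by rw [hp, Functor.map_comp]
      simp only [φ, assoc]
      rw [reassoc_of% this, reassoc_of% hhp, ← reassoc_of% hp, hpg]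
    rw [this, IsIso.hom_inv_id]

end ImageRetracts

/-! ### Approximating objects of an idempotent completion -/

section Karoubi

variable {C : Type u} [Category.{v} C]

/-- An isomorphism in the idempotent completion from an isomorphism of the underlying objects
which is compatible with the idempotents. -/
def karoubiIsoMk {P Q : Karoubi C} (e : P.X ≅ Q.X) (h : P.p ≫ e.hom = e.hom ≫ Q.p) : P ≅ Q where
  hom := ⟨P.p ≫ e.hom, by rw [assoc, ← h, reassoc_of% P.idem, reassoc_of% P.idem]⟩
  inv := ⟨e.inv ≫ P.p, by
    have h' : e.inv ≫ P.p = Q.p ≫ e.inv := by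
      rw [← cancel_epi e.hom, ← cancel_mono e.hom]
      simp [h]
    rw [assoc, P.idem, h', reassoc_of% Q.idem]⟩
  hom_inv_id := by
    ext
    simp [P.idem]
  inv_hom_id := by
    apply Karoubi.hom_ext
    change (e.inv ≫ P.p) ≫ P.p ≫ e.hom = Q.p
    rw [assoc, reassoc_of% P.idem, h, e.inv_hom_id_assoc]

/-- The cone of `1 - p` can be formed in `C` itself. The two retracts show that `z` and `b` lie in
the same thick ideals of the completion. -/
lemma exists_retract_cone_karoubi [Preadditive C] [HasZeroObject C] [HasShift C ℤ]
    [∀ n : ℤ, (shiftFunctor C n).Additive] [Pretriangulated C] (b : Karoubi C) :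
    ∃ z : C, Nonempty (Retract b ((toKaroubi C).obj z)) ∧
      Nonempty (Retract ((toKaroubi C).obj z) (b ⊞ b⟦(1 : ℤ)⟧)) := by
  obtain ⟨z, g, h, hT⟩ := distinguished_cocone_triangle (𝟙 b.X - b.p)
  refine ⟨z, retract_cone (b.retract) (g := (toKaroubi C).map g)
    (h := (toKaroubi C).map h ≫ ((toKaroubi C).commShiftIso (1 : ℤ)).hom.app _) ?_⟩
  have h : 𝟙 _ - b.retract.r ≫ b.retract.i = (toKaroubi C).map (𝟙 b.X - b.p) := by
    rw [Functor.map_sub, CategoryTheory.Functor.map_id]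
    congr 1
    exact Karoubi.hom_ext _ _ b.idem
  rw [h]
  exact (toKaroubi C).map_distinguished _ hT

end Karoubi

/-! ### Morphisms and objects of `K(U)` in terms of `K` -/

section Restriction

variable {K : Type u} [Category.{v} K] [HasZeroObject K] [Preadditive K] [HasShift K ℤ]
  [∀ n : ℤ, (shiftFunctor K n).Additive] [Pretriangulated K]

lemma trW_zero_of_prop (P : ObjectProperty K) [P.IsStableUnderShift ℤ] {x : K} (hx : P x) :
    P.trW (0 : x ⟶ 0) := by
  rw [P.trW_iff']
  exact ⟨_, _, _, contractible_distinguished x, hx⟩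

variable [MonoidalCategory K] (U : Set (Spc K))

lemma isIso_restriction_map {x y : K} (s : x ⟶ y) (hs : (supportedOn Uᶜ).trW s) :
    IsIso ((restriction U).map s) := by
  have := Localization.inverts (supportedOn Uᶜ).trW.Q (supportedOn Uᶜ).trW s hs
  exact inferInstanceAs (IsIso ((toKaroubi _).map ((supportedOn Uᶜ).trW.Q.map s)))

lemma exists_retract_restriction (b : KU U) :
    ∃ x : K, Nonempty (Retract b ((restriction U).obj x)) := by
  have := Localization.essSurj (supportedOn Uᶜ).trW.Q (supportedOn Uᶜ).trW
  exact ⟨_, ⟨b.retract.trans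
    (.ofIso ((toKaroubi _).mapIso ((supportedOn Uᶜ).trW.Q.objObjPreimageIso b.X).symm))⟩⟩

variable [IsTriangulated K]

lemma restriction_exists_fraction {x y : K}
    (g : (restriction U).obj x ⟶ (restriction U).obj y) :
    ∃ (y' : K) (f : x ⟶ y') (s : y ⟶ y'), (supportedOn Uᶜ).trW s ∧
      g ≫ (restriction U).map s = (restriction U).map f := by
  obtain ⟨φ, hφ⟩ := Localization.exists_leftFraction (supportedOn Uᶜ).trW.Q
    (supportedOn Uᶜ).trW g.f
  refine ⟨_, φ.f, φ.s, φ.hs, Karoubi.hom_ext _ _ ?_⟩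
  change g.f ≫ (supportedOn Uᶜ).trW.Q.map φ.s = _
  rw [hφ, φ.map_comp_map_s]
  rfl

lemma exists_retract_cone_restriction (b : KU U) :
    ∃ z : K, Nonempty (Retract b ((restriction U).obj z)) ∧
      Nonempty (Retract ((restriction U).obj z) (b ⊞ b⟦(1 : ℤ)⟧)) := by
  obtain ⟨z, ⟨r₁⟩, ⟨r₂⟩⟩ := exists_retract_cone_karoubi b
  have := Localization.essSurj (supportedOn Uᶜ).trW.Q (supportedOn Uᶜ).trW
  let e := (toKaroubi _).mapIso ((supportedOn Uᶜ).trW.Q.objObjPreimageIso z)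
  exact ⟨_, ⟨r₁.trans (.ofIso e.symm)⟩, ⟨(Retract.ofIso e).trans r₂⟩⟩

lemma isZero_Q_iff_of_isThickTensorIdeal {P : ObjectProperty K} (hP : IsThickTensorIdeal K P)
    (x : K) : IsZero (P.trW.Q.obj x) ↔ P x := by
  have := hP.isTriangulated
  constructor
  · intro h
    -- If `x` dies in the quotient, its identity is killed by some `s` in `P.trW`, so it factors
    -- through an object of `P` and `x` is a retract of that object.
    obtain ⟨z, s, hs, fac⟩ := (MorphismProperty.map_eq_iff_postcomp P.trW.Q P.trW (𝟙 x) 0).1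
      (h.eq_of_src _ _)
    rw [id_comp, zero_comp] at fac
    rw [P.trW_iff'] at hs
    obtain ⟨y, f, g, hT, hy⟩ := hs
    obtain ⟨i, hi⟩ := Triangle.coyoneda_exact₂ _ hT (𝟙 x) (by
      change 𝟙 x ≫ s = 0
      rw [fac, comp_zero])
    exact hP.of_retract ⟨i, f, hi.symm⟩ hy
  · intro h
    have := Localization.inverts P.trW.Q P.trW _ (trW_zero_of_prop P h)
    exact (P.trW.Q.map_isZero (isZero_zero K)).of_iso (asIso (P.trW.Q.map (0 : x ⟶ 0)))

lemma isZero_restriction {x : K} (hx : supportedOn Uᶜ x) : IsZero ((restriction U).obj x) := by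
  have := isIso_restriction_map U _ (trW_zero_of_prop _ hx)
  exact ((restriction U).map_isZero (isZero_zero K)).of_iso
    (asIso ((restriction U).map (0 : x ⟶ 0)))

/-! ### The shift on `K(U)` as a tensor product, and additivity of tensoring -/

variable [TensorTriangulated K]

variable (K) in
/-- The shift is isomorphic to the tensor product with `𝟙⟦1⟧` on the left. -/
noncomputable def shiftIsoTensorLeft : shiftFunctor K (1 : ℤ) ≅ tensorLeft ((𝟙_ K)⟦(1 : ℤ)⟧) :=
  NatIso.ofComponents (fun x => (shiftFunctor K (1 : ℤ)).mapIso (λ_ x).symm ≪≫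
      (((curriedTensor K).flip.obj x).commShiftIso (1 : ℤ)).symm.app (𝟙_ K)) (fun {x y} f => by
    -- Naturality in `x` amounts to the transformation `- ⊗ x ⟶ - ⊗ y` commuting with the shift.
    have h := NatTrans.app_shift ((curriedTensor K).flip.map f) (1 : ℤ) (𝟙_ K)
    change _ ◁ f = _ at h
    change f⟦(1 : ℤ)⟧' ≫ (λ_ y).inv⟦(1 : ℤ)⟧' ≫ _ = ((λ_ x).inv⟦(1 : ℤ)⟧' ≫
      (((curriedTensor K).flip.obj x).commShiftIso (1 : ℤ)).inv.app _) ≫ (_ ◁ f)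
    rw [h, assoc, Iso.inv_hom_id_app_assoc, ← Functor.map_comp_assoc,
      leftUnitor_inv_naturality, Functor.map_comp_assoc]
    rfl)

variable (K) in
/-- The shift is isomorphic to the tensor product with `𝟙⟦1⟧` on the right. -/
noncomputable def shiftIsoTensorRight : shiftFunctor K (1 : ℤ) ≅ tensorRight ((𝟙_ K)⟦(1 : ℤ)⟧) :=
  NatIso.ofComponents (fun x => (shiftFunctor K (1 : ℤ)).mapIso (ρ_ x).symm ≪≫
      (((curriedTensor K).obj x).commShiftIso (1 : ℤ)).symm.app (𝟙_ K)) (fun {x y} f => by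
    have h := NatTrans.app_shift ((curriedTensor K).map f) (1 : ℤ) (𝟙_ K)
    change f ▷ _ = _ at h
    change f⟦(1 : ℤ)⟧' ≫ (ρ_ y).inv⟦(1 : ℤ)⟧' ≫ _ = ((ρ_ x).inv⟦(1 : ℤ)⟧' ≫
      (((curriedTensor K).obj x).commShiftIso (1 : ℤ)).inv.app _) ≫ (f ▷ _)
    rw [h, assoc, Iso.inv_hom_id_app_assoc, ← Functor.map_comp_assoc,
      rightUnitor_inv_naturality, Functor.map_comp_assoc]
    rfl)

variable [SymmetricCategory K]

/-- The shift on the Verdier quotient is a tensor product on the left. -/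
noncomputable def quotientShiftIsoTensorLeft (Z : Set (Spc K)) :
    shiftFunctor (supportedOn Z).trW.Localization (1 : ℤ) ≅
      tensorLeft ((supportedOn Z).trW.Q.obj ((𝟙_ K)⟦(1 : ℤ)⟧)) :=
  letI : Localization.Lifting (supportedOn Z).trW.Q (supportedOn Z).trW
      (shiftFunctor K (1 : ℤ) ⋙ (supportedOn Z).trW.Q) (shiftFunctor _ (1 : ℤ)) :=
    ⟨((supportedOn Z).trW.Q.commShiftIso (1 : ℤ)).symm⟩
  letI : Localization.Lifting (supportedOn Z).trW.Q (supportedOn Z).trW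
      (tensorLeft ((𝟙_ K)⟦(1 : ℤ)⟧) ⋙ (supportedOn Z).trW.Q) (tensorLeft _) :=
    ⟨Functor.Monoidal.commTensorLeft (supportedOn Z).trW.Q ((𝟙_ K)⟦(1 : ℤ)⟧)⟩
  Localization.liftNatIso (supportedOn Z).trW.Q (supportedOn Z).trW _ _ _ _
    (Functor.isoWhiskerRight (shiftIsoTensorLeft K) (supportedOn Z).trW.Q)

/-- The shift on the Verdier quotient is a tensor product on the right. -/
noncomputable def quotientShiftIsoTensorRight (Z : Set (Spc K)) :
    shiftFunctor (supportedOn Z).trW.Localization (1 : ℤ) ≅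
      tensorRight ((supportedOn Z).trW.Q.obj ((𝟙_ K)⟦(1 : ℤ)⟧)) :=
  letI : Localization.Lifting (supportedOn Z).trW.Q (supportedOn Z).trW
      (shiftFunctor K (1 : ℤ) ⋙ (supportedOn Z).trW.Q) (shiftFunctor _ (1 : ℤ)) :=
    ⟨((supportedOn Z).trW.Q.commShiftIso (1 : ℤ)).symm⟩
  letI : Localization.Lifting (supportedOn Z).trW.Q (supportedOn Z).trW
      (tensorRight ((𝟙_ K)⟦(1 : ℤ)⟧) ⋙ (supportedOn Z).trW.Q) (tensorRight _) :=
    ⟨Functor.Monoidal.commTensorRight (supportedOn Z).trW.Q ((𝟙_ K)⟦(1 : ℤ)⟧)⟩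
  Localization.liftNatIso (supportedOn Z).trW.Q (supportedOn Z).trW _ _ _ _
    (Functor.isoWhiskerRight (shiftIsoTensorRight K) (supportedOn Z).trW.Q)

/-- The shift on `K(U)` is a tensor product on the left. -/
noncomputable def shiftObjIsoTensorLeft (b : KU U) :
    b⟦(1 : ℤ)⟧ ≅ (restriction U).obj ((𝟙_ K)⟦(1 : ℤ)⟧) ⊗ b :=
  karoubiIsoMk ((quotientShiftIsoTensorLeft Uᶜ).app b.X) (by
    change b.p⟦(1 : ℤ)⟧' ≫ _ = _ ≫ (𝟙 _ ⊗ₘ b.p)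
    rw [id_tensorHom]
    exact (quotientShiftIsoTensorLeft Uᶜ).hom.naturality b.p)

/-- The shift on `K(U)` is a tensor product on the right. -/
noncomputable def shiftObjIsoTensorRight (b : KU U) :
    b⟦(1 : ℤ)⟧ ≅ b ⊗ (restriction U).obj ((𝟙_ K)⟦(1 : ℤ)⟧) :=
  karoubiIsoMk ((quotientShiftIsoTensorRight Uᶜ).app b.X) (by
    change b.p⟦(1 : ℤ)⟧' ≫ _ = _ ≫ (b.p ⊗ₘ 𝟙 _)
    rw [tensorHom_id]
    exact (quotientShiftIsoTensorRight Uᶜ).hom.naturality b.p)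

/-- Additivity can be tested after precomposition with `Q`, and `X` may be taken in the image of
`Q`. It serves to distribute the tensor product over `b ⊞ b⟦1⟧`. -/
instance (Z : Set (Spc K)) (X : (supportedOn Z).trW.Localization) : (tensorLeft X).Additive := by
  have := Localization.essSurj (supportedOn Z).trW.Q (supportedOn Z).trW
  let x := (supportedOn Z).trW.Q.objPreimage X
  have : (tensorLeft x).Additive := inferInstanceAs ((curriedTensor K).obj x).Additive
  have : ((supportedOn Z).trW.Q ⋙ tensorLeft ((supportedOn Z).trW.Q.obj x)).Additive :=
    Functor.additive_of_iso (Functor.Monoidal.commTensorLeft (supportedOn Z).trW.Q x).symm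
  have := (Localization.functor_additive_iff (supportedOn Z).trW.Q (supportedOn Z).trW _).2 this
  exact Functor.additive_of_iso
    ((tensoringLeft _).mapIso ((supportedOn Z).trW.Q.objObjPreimageIso X))

instance (Z : Set (Spc K)) (X : (supportedOn Z).trW.Localization) : (tensorRight X).Additive := by
  have := Localization.essSurj (supportedOn Z).trW.Q (supportedOn Z).trW
  let x := (supportedOn Z).trW.Q.objPreimage X
  have : (tensorRight x).Additive := inferInstanceAs ((curriedTensor K).flip.obj x).Additive
  have : ((supportedOn Z).trW.Q ⋙ tensorRight ((supportedOn Z).trW.Q.obj x)).Additive :=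
    Functor.additive_of_iso (Functor.Monoidal.commTensorRight (supportedOn Z).trW.Q x).symm
  have := (Localization.functor_additive_iff (supportedOn Z).trW.Q (supportedOn Z).trW _).2 this
  exact Functor.additive_of_iso
    ((tensoringRight _).mapIso ((supportedOn Z).trW.Q.objObjPreimageIso X))

instance (b : KU U) : (tensorLeft b).Additive where
  map_add {x y f g} := by
    apply Karoubi.hom_ext
    change b.p ⊗ₘ (f.f + g.f) = b.p ⊗ₘ f.f + b.p ⊗ₘ g.f
    simp only [MonoidalCategory.tensorHom_def]
    rw [← Preadditive.comp_add]
    congr 1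
    exact (tensorLeft b.X).map_add

instance (b : KU U) : (tensorRight b).Additive where
  map_add {x y f g} := by
    apply Karoubi.hom_ext
    change (f.f + g.f) ⊗ₘ b.p = f.f ⊗ₘ b.p + g.f ⊗ₘ b.p
    simp only [MonoidalCategory.tensorHom_def]
    rw [← Preadditive.add_comp]
    congr 1
    exact (tensorRight b.X).map_add

end Restriction

/-! ### Extending primes in `U` to `K(U)` -/

section Lift

variable {K : Type u} [Category.{v} K] [HasZeroObject K] [Preadditive K] [HasShift K ℤ]
  [∀ n : ℤ, (shiftFunctor K n).Additive] [Pretriangulated K]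
  [MonoidalCategory K] {U : Set (Spc K)}

lemma Spc.supportedOn_compl_le {P : Spc K} (hP : P ∈ U) : supportedOn Uᶜ ≤ P.carrier :=
  fun _ hx => by_contra fun h => hx h hP

variable [IsTriangulated K]

section

variable {P : ObjectProperty K} (hP : IsThickTensorIdeal K P)
include hP

/-- The quotient functor of `K` by `P` factors through the quotient by `supportedOn Uᶜ`. There `y`
becomes zero, hence so does its retract `x`, and the kernel of the quotient functor is `P`. -/
lemma IsThickTensorIdeal.imageRetracts_restriction_obj_iff (hU : supportedOn Uᶜ ≤ P) (x : K) :
    imageRetracts (restriction U) P ((restriction U).obj x) ↔ P x := by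
  refine ⟨?_, imageRetracts_obj⟩
  rintro ⟨y, hy, ⟨r⟩⟩
  have hW : (supportedOn Uᶜ).trW.IsInvertedBy P.trW.Q := fun _ _ f hf =>
    Localization.inverts P.trW.Q P.trW f (ObjectProperty.trW_monotone hU f hf)
  let G := Localization.lift P.trW.Q hW (supportedOn Uᶜ).trW.Q
  let e : (supportedOn Uᶜ).trW.Q ⋙ G ≅ P.trW.Q := Localization.fac _ hW _
  let r' : Retract ((supportedOn Uᶜ).trW.Q.obj x) ((supportedOn Uᶜ).trW.Q.obj y) :=
    ⟨r.i.f, r.r.f, congrArg Karoubi.Hom.f r.retract⟩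
  have := hP.isTriangulated
  rw [← isZero_Q_iff_of_isThickTensorIdeal hP] at hy ⊢
  let r'' : Retract (P.trW.Q.obj x) (P.trW.Q.obj y) :=
    ((Retract.ofIso (e.app x).symm).trans (r'.map G)).trans (.ofIso (e.app y))
  rw [IsZero.iff_id_eq_zero, ← r''.retract, hy.eq_zero_of_tgt r''.i, zero_comp]

/-- The denominator `y ⟶ y'` of a fraction has its cone in `supportedOn Uᶜ ≤ P`, so `y'` stays in
`P`. This is the lifting hypothesis of `imageRetracts_cone`. -/
lemma IsThickTensorIdeal.exists_fraction_of_supportedOn_le (hU : supportedOn Uᶜ ≤ P) (x y : K)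
    (g : (restriction U).obj x ⟶ (restriction U).obj y) (hy : P y) :
    ∃ (y' : K) (f : x ⟶ y') (e : (restriction U).obj y ≅ (restriction U).obj y'), P y' ∧
      g ≫ e.hom = (restriction U).map f := by
  obtain ⟨y', f, s, hs, h⟩ := restriction_exists_fraction U g
  have := isIso_restriction_map U s hs
  refine ⟨y', f, asIso ((restriction U).map s), ?_, h⟩
  obtain ⟨z, a, b, hT, hz⟩ := hs
  have := hP.isTriangulated
  have := hP.isClosedUnderIsomorphisms
  exact P.ext_of_isTriangulatedClosed₂ _ hT hy (hU _ hz)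

end

variable [SymmetricCategory K] [TensorTriangulated K]

lemma imageRetracts_restriction_tensor_right {S : ObjectProperty K}
    (hS : ∀ x y : K, S x → S (x ⊗ y)) {b : KU U} (c : KU U)
    (hb : imageRetracts (restriction U) S b) : imageRetracts (restriction U) S (b ⊗ c) := by
  obtain ⟨x, hx, ⟨r⟩⟩ := hb
  obtain ⟨y, ⟨r'⟩⟩ := exists_retract_restriction U c
  exact ⟨x ⊗ y, hS x y hx, ⟨Retract.trans ⟨r.i ⊗ₘ r'.i, r.r ⊗ₘ r'.r, by
    rw [tensorHom_comp_tensorHom, r.retract, r'.retract, id_tensorHom_id]⟩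
    (.ofIso (Functor.Monoidal.μIso (restriction U) x y))⟩⟩

lemma imageRetracts_restriction_tensor_left {S : ObjectProperty K}
    (hS : ∀ x y : K, S y → S (x ⊗ y)) (b : KU U) {c : KU U}
    (hc : imageRetracts (restriction U) S c) : imageRetracts (restriction U) S (b ⊗ c) := by
  obtain ⟨y, hy, ⟨r'⟩⟩ := hc
  obtain ⟨x, ⟨r⟩⟩ := exists_retract_restriction U b
  exact ⟨x ⊗ y, hS x y hy, ⟨Retract.trans ⟨r.i ⊗ₘ r'.i, r.r ⊗ₘ r'.r, by
    rw [tensorHom_comp_tensorHom, r.retract, r'.retract, id_tensorHom_id]⟩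
    (.ofIso (Functor.Monoidal.μIso (restriction U) x y))⟩⟩

namespace IsThickTensorIdeal

variable {P : ObjectProperty K} (hP : IsThickTensorIdeal K P)
include hP

lemma imageRetracts_restriction (hU : supportedOn Uᶜ ≤ P) :
    IsThickTensorIdeal (KU U) (imageRetracts (restriction U) P) where
  zero := imageRetracts_of_retract (.ofIso (restriction U).mapZeroObject.symm)
    (imageRetracts_obj hP.zero)
  shift := imageRetracts_shift (fun c n => (hP.shift_iff c n).2)
  cone T hT h₁ h₂ := imageRetracts_cone hP.cone
    (fun x y g _ hy => hP.exists_fraction_of_supportedOn_le hU x y g hy) T hT h₁ h₂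
  summand b c h := ⟨imageRetracts_of_retract ⟨biprod.inl, biprod.fst, by simp⟩ h,
    imageRetracts_of_retract ⟨biprod.inr, biprod.snd, by simp⟩ h⟩
  tensor b c h := imageRetracts_restriction_tensor_right hP.tensor c h

lemma imageRetracts_restriction_biprod_tensor (hU : supportedOn Uᶜ ≤ P) {b : KU U} (c : KU U)
    (h : imageRetracts (restriction U) P (b ⊗ c)) :
    imageRetracts (restriction U) P ((b ⊞ b⟦(1 : ℤ)⟧) ⊗ c) := by
  have := preservesBinaryBiproducts_of_preservesBiproducts (tensorRight c)
  refine (hP.imageRetracts_restriction hU).of_iso ((tensorRight c).mapBiprod _ _).symm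
    ((hP.imageRetracts_restriction hU).biprod h ?_)
  exact (hP.imageRetracts_restriction hU).of_iso
    ((α_ _ _ _).symm ≪≫ whiskerRightIso (shiftObjIsoTensorLeft U b).symm c)
    (imageRetracts_restriction_tensor_left hP.tensor_left _ h)

lemma imageRetracts_restriction_tensor_biprod (hU : supportedOn Uᶜ ≤ P) (b : KU U) {c : KU U}
    (h : imageRetracts (restriction U) P (b ⊗ c)) :
    imageRetracts (restriction U) P (b ⊗ (c ⊞ c⟦(1 : ℤ)⟧)) := by
  have := preservesBinaryBiproducts_of_preservesBiproducts (tensorLeft b)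
  refine (hP.imageRetracts_restriction hU).of_iso ((tensorLeft b).mapBiprod _ _).symm
    ((hP.imageRetracts_restriction hU).biprod h ?_)
  exact (hP.imageRetracts_restriction hU).of_iso
    (α_ _ _ _ ≪≫ whiskerLeftIso b (shiftObjIsoTensorRight U c).symm)
    (imageRetracts_restriction_tensor_right hP.tensor _ h)

end IsThickTensorIdeal

/-- A prime in `U` extends to a prime of `K(U)`. -/
def Spc.extend (P : Spc K) (hP : P ∈ U) : Spc (KU U) where
  carrier := imageRetracts (restriction U) P.carrier
  isThickTensorIdeal := P.isThickTensorIdeal.imageRetracts_restriction (P.supportedOn_compl_le hP)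
  proper := by
    obtain ⟨a, ha⟩ := P.proper
    exact ⟨_, fun h => ha ((P.isThickTensorIdeal.imageRetracts_restriction_obj_iff
      (P.supportedOn_compl_le hP) a).1 h)⟩
  prime b c h := by
    have hU := P.supportedOn_compl_le hP
    -- Replacing `b` and `c` by the restrictions of `z` and `w` moves the question to `z ⊗ w` in
    -- `K`, where `P` is prime; `r₁` and `s₁` bring the answer back.
    obtain ⟨z, ⟨r₁⟩, ⟨r₂⟩⟩ := exists_retract_cone_restriction U b
    obtain ⟨w, ⟨s₁⟩, ⟨s₂⟩⟩ := exists_retract_cone_restriction U c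
    have h₁ := imageRetracts_of_retract (r₂.map (tensorRight c))
      (P.isThickTensorIdeal.imageRetracts_restriction_biprod_tensor hU c h)
    have h₂ := imageRetracts_of_retract (s₂.map (tensorLeft ((restriction U).obj z)))
      (P.isThickTensorIdeal.imageRetracts_restriction_tensor_biprod hU _ h₁)
    have h₃ := (P.isThickTensorIdeal.imageRetracts_restriction hU).of_iso
      (Functor.Monoidal.μIso (restriction U) z w) h₂
    rw [P.isThickTensorIdeal.imageRetracts_restriction_obj_iff hU] at h₃
    exact (P.prime _ _ h₃).imp (fun h => ⟨z, h, ⟨r₁⟩⟩) (fun h => ⟨w, h, ⟨s₁⟩⟩)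

lemma Spc.comap_extend (P : Spc K) (hP : P ∈ U) :
    Spc.comap (restriction U) (P.extend hP) = P := by
  have h : (Spc.comap (restriction U) (P.extend hP)).carrier = P.carrier := by
    ext x
    exact P.isThickTensorIdeal.imageRetracts_restriction_obj_iff (P.supportedOn_compl_le hP) x
  generalize Spc.comap (restriction U) (P.extend hP) = P' at h
  cases P
  cases P'
  cases h
  rfl

/-- A prime `P` in `U` but not in `Y` extends to a prime `Q` lying over `P`. The support condition
forces `b` into `Q`, hence also `ρ(z)`, and contracting gives `z` in `P`. -/
lemma supp_subset_of_retract {Y : Set (Spc K)} {b : KU U} (hb : supportedOnKU U Y b) {z : K}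
    (r : Retract ((restriction U).obj z) (b ⊞ b⟦(1 : ℤ)⟧)) : supp z ⊆ Y ∪ Uᶜ := by
  intro P hz
  by_contra! h
  rw [Set.mem_union, Set.mem_compl_iff, not_or, not_not] at h
  refine hz ?_
  let Q := P.extend h.2
  have hQb : Q.carrier b := by
    by_contra hQ
    have : Spc.comap (restriction U) Q ∈ Y := hb hQ
    rw [P.comap_extend h.2] at this
    exact h.1 this
  have hQz : Q.carrier ((restriction U).obj z) := Q.isThickTensorIdeal.of_retract r
    (Q.isThickTensorIdeal.biprod hQb ((Q.isThickTensorIdeal.shift b).2 hQb))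
  exact (P.isThickTensorIdeal.imageRetracts_restriction_obj_iff
    (P.supportedOn_compl_le h.2) z).1 hQz

end Lift

/-! ### Full faithfulness and essential surjectivity -/

section Excision

variable {K : Type u} [Category.{v} K] [HasZeroObject K] [Preadditive K] [HasShift K ℤ]
  [∀ n : ℤ, (shiftFunctor K n).Additive] [Pretriangulated K] [IsTriangulated K]
  [MonoidalCategory K] [SymmetricCategory K] [TensorTriangulated K]
  [MonoidalClosed K] [StronglyClosed K] {U Y : Set (Spc K)}

/-- Only the source needs support in `U`: the obstructions to lifting a fraction, and to uniqueness
of the lift, are morphisms from `x` to objects supported on `Uᶜ`, which vanish. -/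
lemma restriction_map_bijective {x : K} (hx : supportedOn U x) (y : K) :
    Function.Bijective ((restriction U).map : (x ⟶ y) → _) := by
  have hzero {z : K} (hz : supportedOn Uᶜ z) (f : x ⟶ z) : f = 0 :=
    eq_zero_of_disjoint_supp (disjoint_compl_right.mono hx hz) f
  constructor
  · intro f f' h
    obtain ⟨y', s, hs, h'⟩ := (MorphismProperty.map_eq_iff_postcomp (supportedOn Uᶜ).trW.Q
      (supportedOn Uᶜ).trW f f').1 ((toKaroubi _).map_injective h)
    rw [ObjectProperty.trW_iff'] at hs
    obtain ⟨w, a, b, hT, hw⟩ := hs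
    obtain ⟨k, hk⟩ : ∃ k : x ⟶ w, f - f' = k ≫ a :=
      Triangle.coyoneda_exact₂ _ hT (f - f') (by
        change (f - f') ≫ s = 0
        rw [Preadditive.sub_comp, h', sub_self])
    rw [hzero hw k, zero_comp, sub_eq_zero] at hk
    exact hk
  · intro g
    obtain ⟨y', f, s, hs, h⟩ := restriction_exists_fraction U g
    have := isIso_restriction_map U s hs
    obtain ⟨w, a, b, hT, hw⟩ := hs
    obtain ⟨k, hk⟩ : ∃ k : x ⟶ y, f = k ≫ s :=
      Triangle.coyoneda_exact₂ _ hT f (hzero hw _)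
    refine ⟨k, ?_⟩
    rw [← cancel_mono ((restriction U).map s), h, hk]
    exact ((restriction U).map_comp k s).symm

/-- The ideal of objects whose restriction to `U` is a retract of the restriction of an object
supported on `Y`. -/
lemma isThickTensorIdeal_inverseImage_imageRetracts (hYU : Y ⊆ U) :
    IsThickTensorIdeal K
      ((imageRetracts (restriction U) (supportedOn Y)).inverseImage (restriction U)) where
  zero := imageRetracts_obj (isThickTensorIdeal_supportedOn Y).zero
  shift a := Iff.trans
    ⟨imageRetracts_of_retract (.ofIso (((restriction U).commShiftIso (1 : ℤ)).app a).symm),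
      imageRetracts_of_retract (.ofIso (((restriction U).commShiftIso (1 : ℤ)).app a))⟩
    (imageRetracts_shift
      (fun c n => ((isThickTensorIdeal_supportedOn Y).shift_iff c n).2) ((restriction U).obj a))
  cone T hT h₁ h₂ := imageRetracts_cone (isThickTensorIdeal_supportedOn Y).cone
    -- Here `g` lifts to `K` without changing its target, because `x` is supported on `Y ⊆ U`.
    (fun x y g hx hy => by
      obtain ⟨f, hf⟩ := (restriction_map_bijective (hx.trans hYU) y).2 g
      exact ⟨y, f, Iso.refl _, hy, by rw [Iso.refl_hom, comp_id, hf]⟩) _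
    ((restriction U).map_distinguished T hT) h₁ h₂
  summand a b h :=
    ⟨imageRetracts_of_retract (Retract.map ⟨biprod.inl, biprod.fst, by simp⟩ (restriction U)) h,
      imageRetracts_of_retract (Retract.map ⟨biprod.inr, biprod.snd, by simp⟩ (restriction U)) h⟩
  tensor a b h := imageRetracts_of_retract
    (.ofIso (Functor.Monoidal.μIso (restriction U) a b).symm)
    (imageRetracts_restriction_tensor_right (isThickTensorIdeal_supportedOn Y).tensor _ h)

/-- Otherwise some prime `P` contains the ideal of `isThickTensorIdeal_inverseImage_imageRetracts`
but not `a`, so `P` is in `Y` or in `Uᶜ`. Either way `P` lies in the support of some `c` supported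
on that set; but such a `c` belongs to the ideal, since `ρ(c)` is zero in the second case. -/
lemma imageRetracts_restriction_of_supp_subset (hYU : Y ⊆ U)
    (hY : ∀ P ∈ Y, ∃ c : K, P ∈ supp c ∧ supp c ⊆ Y)
    (hU : ∀ P ∈ Uᶜ, ∃ c : K, P ∈ supp c ∧ supp c ⊆ Uᶜ) {a : K} (ha : supp a ⊆ Y ∪ Uᶜ) :
    imageRetracts (restriction U) (supportedOn Y) ((restriction U).obj a) := by
  by_contra h
  obtain ⟨P, hP, haP⟩ :=
    (isThickTensorIdeal_inverseImage_imageRetracts hYU).exists_prime h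
  obtain hP' | hP' := ha haP
  · obtain ⟨c, hc, hcY⟩ := hY P hP'
    exact hc (hP _ (imageRetracts_obj hcY))
  · obtain ⟨c, hc, hcU⟩ := hU P hP'
    refine hc (hP _ ⟨0, (isThickTensorIdeal_supportedOn Y).zero, ⟨?_⟩⟩)
    exact (isZero_restriction U hcU).retract _

lemma restrictionOn_full (hYU : Y ⊆ U) : (restrictionOn U Y).Full := by
  have : ((supportedOn Y).ι ⋙ restriction U).Full := ⟨fun {x y} g => by
    obtain ⟨f, hf⟩ := (restriction_map_bijective (x.property.trans hYU) y.obj).2 g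
    exact ⟨⟨f⟩, hf⟩⟩
  exact inferInstanceAs ((supportedOnKU U Y).lift _ _).Full

lemma restrictionOn_faithful (hYU : Y ⊆ U) : (restrictionOn U Y).Faithful := by
  have : ((supportedOn Y).ι ⋙ restriction U).Faithful := ⟨fun {x y} f f' h => by
    ext
    exact (restriction_map_bijective (x.property.trans hYU) y.obj).1 h⟩
  exact inferInstanceAs ((supportedOnKU U Y).lift _ _).Faithful

lemma restrictionOn_essSurj [IsIdempotentComplete K] (hYU : Y ⊆ U)
    (hY : ∀ P ∈ Y, ∃ c : K, P ∈ supp c ∧ supp c ⊆ Y)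
    (hU : ∀ P ∈ Uᶜ, ∃ c : K, P ∈ supp c ∧ supp c ⊆ Uᶜ) : (restrictionOn U Y).EssSurj where
  mem_essImage b := by
    obtain ⟨z, ⟨r₁⟩, ⟨r₂⟩⟩ := exists_retract_cone_restriction U b.obj
    obtain ⟨c, hc, ⟨r₃⟩⟩ := imageRetracts_restriction_of_supp_subset hYU hY hU
      (supp_subset_of_retract b.property r₂)
    let r := r₁.trans r₃
    have hbij := restriction_map_bijective (hc.trans hYU) c
    -- The idempotent of `b` on `ρ(c)` lifts to an idempotent of `c` in `K`; the image of its
    -- splitting and `b` split the same idempotent, so they are isomorphic.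
    obtain ⟨p, hp⟩ := hbij.2 (r.r ≫ r.i)
    have hpp : p ≫ p = p := hbij.1 (by simp [-Functor.comp_map, hp])
    obtain ⟨d, i, e, hie, hei⟩ := IsIdempotentComplete.idempotents_split c p hpp
    have hie' : (restriction U).map i ≫ (restriction U).map e = 𝟙 _ :=
      ((restriction U).map_comp i e).symm.trans ((congrArg _ hie).trans ((restriction U).map_id d))
    have hei' : r.r ≫ r.i = (restriction U).map e ≫ (restriction U).map i := by
      rw [← hp, ← hei]
      exact (restriction U).map_comp e i
    have hd : supportedOn Y d := (isThickTensorIdeal_supportedOn Y).of_retract ⟨i, e, hie⟩ hc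
    refine ⟨⟨d, hd⟩, ⟨(supportedOnKU U Y).fullyFaithfulι.preimageIso ?_⟩⟩
    exact retractIsoOfEq (r := ⟨(restriction U).map i, (restriction U).map e, hie'⟩) r hei'.symm

end Excision

end TensorTriangular

theorem mainTheorem7 {K : Type u} [Category.{v} K] [EssentiallySmall.{w} K]
    [HasZeroObject K] [Preadditive K] [HasShift K ℤ] [∀ n : ℤ, (shiftFunctor K n).Additive]
    [Pretriangulated K] [IsTriangulated K]
    [MonoidalCategory K] [SymmetricCategory K] [TensorTriangular.TensorTriangulated K]
    [MonoidalClosed K] [TensorTriangular.StronglyClosed K] [IsIdempotentComplete K]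
    {A : Type*} {B : Type*}
    (Yα : A → Set (TensorTriangular.Spc K)) (Uβ : B → Set (TensorTriangular.Spc K))
    (hY_closed : ∀ α, IsClosed (Yα α)) (hY_compl : ∀ α, IsCompact (Yα α)ᶜ)
    (hU_open : ∀ β, IsOpen (Uβ β)) (hU_compact : ∀ β, IsCompact (Uβ β))
    (Y U : Set (TensorTriangular.Spc K)) (hY : Y = ⋃ α, Yα α) (hU : U = ⋂ β, Uβ β)
    (hYU : Y ⊆ U) :
    (TensorTriangular.restrictionOn U Y).IsEquivalence := by
  -- The topological hypotheses enter only in this form: `Y` and `Uᶜ` are unions of supports of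
  -- objects.
  have hY' : ∀ P ∈ Y, ∃ c : K, P ∈ TensorTriangular.supp c ∧ TensorTriangular.supp c ⊆ Y := by
    intro P hP
    rw [hY, Set.mem_iUnion] at hP
    obtain ⟨α, hα⟩ := hP
    obtain ⟨c, hc⟩ := TensorTriangular.exists_supp_eq (hY_closed α) (hY_compl α)
    exact ⟨c, hc ▸ hα, hc ▸ hY ▸ Set.subset_iUnion Yα α⟩
  have hU' : ∀ P ∈ Uᶜ, ∃ c : K, P ∈ TensorTriangular.supp c ∧ TensorTriangular.supp c ⊆ Uᶜ := by
    intro P hP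
    rw [hU, Set.mem_compl_iff, Set.mem_iInter, not_forall] at hP
    obtain ⟨β, hβ⟩ := hP
    obtain ⟨c, hc⟩ := TensorTriangular.exists_supp_eq (hU_open β).isClosed_compl
      ((compl_compl (Uβ β)).symm ▸ hU_compact β)
    exact ⟨c, hc ▸ hβ, hc ▸ hU ▸ Set.compl_subset_compl.2 (Set.iInter_subset Uβ β)⟩
  have := TensorTriangular.restrictionOn_full hYU
  have := TensorTriangular.restrictionOn_faithful hYU
  have := TensorTriangular.restrictionOn_essSurj hYU hY' hU'
  exact { }
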